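/- **Theorem 2.5.** Let $G=\mathrm{Spec}\,A$ be a connected (smooth) affine algebraic group over $\mathbb C$ with Lie algebra $\mathfrak g$, and let $T=\mathrm{Der}_{\mathbb C}(A)$, $\Omega=\Omega^1_{A/\mathbb C}=\mathrm{Hom}_A(T,A)$. Let $i_L,i_R:\mathfrak g\hookrightarrow T$ be the embeddings of Lie algebras as left-invariant, respectively right-invariant, vector fields: $i_L(\tau)$ and $i_R(\tau)$ are the infinitesimal actions of $\tau$ on $A$ coming from the actions $(g,x)\mapsto xg^{-1}$ and $(g,x)\mapsto gx$ of $G$ on itself, so that $[i_L(\tau),i_R(\tau')]=0$. Let $(\,,)$ be a symmetric ad-invariant bilinear form on $\mathfrak g$, and let $(\,,)^o=-(\,,)_{K}-(\,,)$ be the dual level, where $(x,y)_K=\mathrm{tr}_{\mathfrak g}(\mathrm{ad}_x\,\mathrm{ad}_y)$ is the Killing form. Let $\mathcal A_{G;(,)}=(A,T,\Omega,d,\gamma,\langle\,,\rangle,c)$ be the vertex $A$-algebroid determined by $\gamma(a,i_L(\tau))=0$, $\langle i_L(\tau),i_L(\tau')\rangle=(\tau,\tau')$ and $c(i_L(\tau),i_L(\tau'))=0$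 for $a\in A$, $\tau,\tau'\in\mathfrak g$, and let $\mathcal D=\mathcal D^{ch}_{G;(,)}$ be the algebra of chiral differential operators on $G$ given by its vertex envelope. So $\mathcal D$ is a $\mathbb Z_{\ge 0}$-graded vertex algebra with vertex algebroid $\mathcal A_{G;(,)}$, with $\mathcal D_0=A$ and $\mathcal D_1=T\oplus\Omega$ (in particular $a_{(-1)}\tau=a\tau-\gamma(a,\tau)$, $\tau_{(1)}\tau'=\langle\tau,\tau'\rangle$, $\tau_{(0)}\tau'=[\tau,\tau']-c(\tau,\tau')+\tfrac12 d\langle\tau,\tau'\rangle$ and $\tau_{(1)}\omega=\langle\tau,\omega\rangle$ for $a\in A$, $\tau,\tau'\in T$, $\omega\in\Omega$), and every morphism from $\mathcal A_{G;(,)}$ to (the vertex algebroid of) a $\mathbb Z_{\ge 0}$-graded vertex algebra extends uniquely to a morphism from $\mathcal D$. Let $j_L:\mathfrak g\to\mathcal D_1$, $j_L(\tau)=(i_L(\tau),0)$. (i) There exists a unique linear embedding $j_R:\mathfrak g\hookrightarrow\mathcal D_1$ such that (a) the composition of $j_R$ with the canonical projection $\mathcal D_1=T\oplus\Omega\to T$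 is $i_R$; (b) $j_L(\tau)_{(n)}j_R(\tau')=0$ for all $\tau,\tau'\in\mathfrak g$ and all $n\ge 0$. (ii) For all $\tau,\tau'\in\mathfrak g$, $$j_R(\tau)_{(1)}j_R(\tau')=(\tau,\tau')^o\cdot\mathbf 1,\qquad j_R(\tau)_{(0)}j_R(\tau')=j_R([\tau,\tau']).$$ -/

import Mathlib

open scoped TensorProduct
universe u
noncomputable section

namespace ChiralDiffOp

/-- Vector fields on `Spec A`: `T = Der A`. -/
abbrev VectorFields (A : Type u) [CommRing A] [Algebra ℂ A] : Type u := Derivation ℂ A A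

section Group

variable (A : Type u) [CommRing A] [HopfAlgebra ℂ A]

/-- The Lie algebra of `G = Spec A`: the left-invariant vector fields on `G`, that is, the
derivations `D` of `A` with `Δ ∘ D = (id ⊗ D) ∘ Δ`, under the commutator. -/
def leftInvariant : LieSubalgebra ℂ (VectorFields A) where
  carrier := {D | Coalgebra.comul ∘ₗ (D : A →ₗ[ℂ] A) =
    (D : A →ₗ[ℂ] A).lTensor A ∘ₗ Coalgebra.comul}
  zero_mem' := by ext; simp
  add_mem' {D E} hD hE := by
    simp only [Set.mem_ofPred_eq, Derivation.coe_add_linearMap, LinearMap.comp_add,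
      LinearMap.lTensor_add, LinearMap.add_comp] at *
    rw [hD, hE]
  smul_mem' c D hD := by
    simp only [Set.mem_ofPred_eq, Derivation.coe_smul_linearMap, LinearMap.comp_smul,
      LinearMap.lTensor_smul, LinearMap.smul_comp] at *
    rw [hD]
  lie_mem' {D E} hD hE := by
    have hD' := fun a ↦ LinearMap.congr_fun hD a
    have hE' := fun a ↦ LinearMap.congr_fun hE a
    simp only [LinearMap.comp_apply, Derivation.coeFn_coe] at hD' hE'
    refine LinearMap.ext fun a ↦ ?_
    have h : ((⁅D, E⁆ : VectorFields A) : A →ₗ[ℂ] A) =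
        (D : A →ₗ[ℂ] A) ∘ₗ (E : A →ₗ[ℂ] A) - (E : A →ₗ[ℂ] A) ∘ₗ (D : A →ₗ[ℂ] A) := rfl
    rw [h]
    simp only [LinearMap.comp_sub, LinearMap.sub_apply, LinearMap.comp_apply,
      Derivation.coeFn_coe, LinearMap.lTensor_sub, LinearMap.lTensor_comp, hD', hE']

/-- The Lie algebra of `G = Spec A`. -/
abbrev LieAlg : Type u := leftInvariant A

variable {A}

/-- The embedding of the Lie algebra into the vector fields as left-invariant vector fields. -/
def iL : LieAlg A →ₗ⁅ℂ⁆ VectorFields A := (leftInvariant A).incl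

lemma comul_iL (x : LieAlg A) (f : A) :
    Coalgebra.comul (R := ℂ) (iL x f) =
      ((iL x : VectorFields A) : A →ₗ[ℂ] A).lTensor A (Coalgebra.comul (R := ℂ) f) :=
  LinearMap.congr_fun x.2 f

lemma antipode_antipode (f : A) :
    HopfAlgebra.antipode ℂ (HopfAlgebra.antipode ℂ f) = f := by
  have h := inv_inv (WithConv.toConv (AlgHom.id ℂ A))
  exact DFunLike.congr_fun (congrArg WithConv.ofConv h) f

/-- The embedding of the Lie algebra into the vector fields as right-invariant vector fields:
`D ↦ S ∘ D ∘ S`, where the antipode `S` is pull-back along the inversion of `G`. The inversion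
exchanges the action of `G` on itself by `(g, x) ↦ x g⁻¹` with the one by `(g, x) ↦ g x`, so this
is the infinitesimal action of the latter, as `D ↦ D` is that of the former. -/
def iR : LieAlg A →ₗ⁅ℂ⁆ VectorFields A where
  toFun x := Derivation.mk'
    (HopfAlgebra.antipode ℂ ∘ₗ ((iL x : VectorFields A) : A →ₗ[ℂ] A) ∘ₗ HopfAlgebra.antipode ℂ)
    fun a b ↦ by
      simp [HopfAlgebra.antipode_mul_distrib, antipode_antipode]
  map_add' x y := by ext; simp
  map_smul' c x := by ext; simp
  map_lie' {x y} := by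
    ext a
    have h (b : A) : iL ⁅x, y⁆ b = iL x (iL y b) - iL y (iL x b) := rfl
    simp [Derivation.commutator_apply, antipode_antipode, h, -LieHom.map_lie]

lemma iR_apply (x : LieAlg A) (f : A) :
    iR x f = HopfAlgebra.antipode ℂ (iL x (HopfAlgebra.antipode ℂ f)) := rfl

end Group

section Frame

variable (A : Type u) [CommRing A] [HopfAlgebra ℂ A]

/-- The map `A ⊗ 𝔤 → T`, `a ⊗ x ↦ a x`. -/
def frameMap : A ⊗[ℂ] LieAlg A →ₗ[A] VectorFields A :=
  TensorProduct.AlgebraTensorModule.lift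
    ((LinearMap.toSpanSingleton A _ (iL (A := A) : LieAlg A →ₗ[ℂ] VectorFields A)))

variable {A}

@[simp] lemma frameMap_tmul (a : A) (x : LieAlg A) : frameMap A (a ⊗ₜ x) = a • iL x := rfl

lemma frameMap_injective : Function.Injective (frameMap A) := by
  rw [injective_iff_map_eq_zero]
  intro z hz
  let ev (f : A) : A ⊗[ℂ] LieAlg A →ₗ[ℂ] A :=
    TensorProduct.lift (LinearMap.mk₂ ℂ
      (fun a x ↦ (Coalgebra.counit (R := ℂ) (iL x f)) • a)
      (by intros; simp) (by intro c a x; rw [smul_comm])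
      (by intros; simp [add_smul]) (by intros; simp [smul_smul]))
  have hev (f : A) (z : A ⊗[ℂ] LieAlg A) : ev f z =
      LinearMap.mul' ℂ A (TensorProduct.map (HopfAlgebra.antipode ℂ)
        ((frameMap A z : VectorFields A) : A →ₗ[ℂ] A) (Coalgebra.comul (R := ℂ) f)) := by
    induction z with
    | zero => simp
    | add x y hx hy => simp [hx, hy, TensorProduct.map_add_right]
    | tmul a x =>
      have h1 := congrArg (fun t ↦ a * LinearMap.mul' ℂ A
        ((HopfAlgebra.antipode ℂ).rTensor A t)) (comul_iL x f)
      simp only [HopfAlgebra.mul_antipode_rTensor_comul_apply] at h1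
      have h2 (t : A ⊗[ℂ] A) : a * LinearMap.mul' ℂ A
          ((HopfAlgebra.antipode ℂ).rTensor A
            (((iL x : VectorFields A) : A →ₗ[ℂ] A).lTensor A t)) =
          LinearMap.mul' ℂ A (TensorProduct.map (HopfAlgebra.antipode ℂ)
          ((frameMap A (a ⊗ₜ x) : VectorFields A) : A →ₗ[ℂ] A) t) := by
        induction t with
        | zero => simp
        | add u v hu hv => simp only [map_add, mul_add, hu, hv]
        | tmul u v => simp; ring
      rw [← h2, ← h1]
      simp [ev, Algebra.smul_def, mul_comm]
  have hev0 (f : A) : ev f z = 0 := by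
    rw [hev, hz]; simp
  classical
  let b := Module.Basis.ofVectorSpace ℂ A
  let e := TensorProduct.equivFinsuppOfBasisLeft (M := A) (N := LieAlg A) b
  have he (f : A) (z : A ⊗[ℂ] LieAlg A) (i) :
      b.repr (ev f z) i = Coalgebra.counit (R := ℂ) (iL (e z i) f) := by
    induction z with
    | zero => simp
    | add x y hx hy => simp [hx, hy]
    | tmul a x => simp [ev, e, mul_comm]
  refine e.injective ?_
  rw [map_zero]
  ext i f
  have h0 (g : A) : Coalgebra.counit (R := ℂ) (iL (e z i) g) = 0 := by
    rw [← he, hev0]; simp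
  have h1 := Coalgebra.lTensor_counit_comul (R := ℂ) (iL (e z i) f)
  rw [comul_iL, ← LinearMap.comp_apply, ← LinearMap.lTensor_comp] at h1
  have h2 : Coalgebra.counit (R := ℂ) ∘ₗ ((iL (e z i) : VectorFields A) : A →ₗ[ℂ] A) = 0 :=
    LinearMap.ext h0
  rw [h2] at h1
  have h3 := congrArg (TensorProduct.rid ℂ A) h1
  have h4 : iL (e z i) f = 0 := by simpa using h3.symm
  exact h4

/-- A point derivation `ξ` at the identity extends to the left-invariant vector field
`(id ⊗ ξ) ∘ Δ`. -/
def ofPointDerivation (ξ : A →ₗ[ℂ] ℂ)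
    (hξ : ∀ f g, ξ (f * g) = Coalgebra.counit (R := ℂ) f * ξ g + Coalgebra.counit (R := ℂ) g * ξ f) :
    LieAlg A :=
  ⟨Derivation.mk' ((TensorProduct.rid ℂ A).toLinearMap ∘ₗ ξ.lTensor A ∘ₗ Coalgebra.comul)
    (by
      have key (p q : A ⊗[ℂ] A) : TensorProduct.rid ℂ A (ξ.lTensor A (p * q)) =
          TensorProduct.rid ℂ A ((Coalgebra.counit (R := ℂ)).lTensor A p) *
            TensorProduct.rid ℂ A (ξ.lTensor A q) +
          TensorProduct.rid ℂ A ((Coalgebra.counit (R := ℂ)).lTensor A q) *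
            TensorProduct.rid ℂ A (ξ.lTensor A p) := by
        induction p with
        | zero => simp
        | add p p' hp hp' => simp only [add_mul, map_add, hp, hp', mul_add]; ring
        | tmul a b =>
          induction q with
          | zero => simp
          | add q q' hq hq' => simp only [add_mul, map_add, hq, hq', mul_add]; ring
          | tmul c d =>
            simp only [Algebra.TensorProduct.tmul_mul_tmul, LinearMap.lTensor_tmul, hξ,
              TensorProduct.rid_tmul, Algebra.smul_def, map_add, map_mul]
            ring
      intro a b
      have := key (Coalgebra.comul (R := ℂ) a) (Coalgebra.comul (R := ℂ) b)
      rw [← Bialgebra.comul_mul] at this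
      simpa using this),
  by
    refine LinearMap.ext fun a ↦ ?_
    have h := Coalgebra.coassoc_apply (R := ℂ) a
    have e1 (t : A ⊗[ℂ] A) : Coalgebra.comul (R := ℂ) (TensorProduct.rid ℂ A (ξ.lTensor A t)) =
        TensorProduct.rid ℂ (A ⊗[ℂ] A)
          (ξ.lTensor (A ⊗[ℂ] A) ((Coalgebra.comul (R := ℂ)).rTensor A t)) := by
      induction t with
      | zero => simp
      | add u v hu hv => simp only [map_add, hu, hv]
      | tmul u v => simp
    have e2 (t : (A ⊗[ℂ] A) ⊗[ℂ] A) : TensorProduct.rid ℂ (A ⊗[ℂ] A)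
          (ξ.lTensor (A ⊗[ℂ] A) t) =
        ((TensorProduct.rid ℂ A).toLinearMap ∘ₗ ξ.lTensor A).lTensor A
          (TensorProduct.assoc ℂ A A A t) := by
      induction t with
      | zero => simp
      | add u v hu hv => simp only [map_add, hu, hv]
      | tmul u v =>
        induction u with
        | zero => simp
        | add u w hu hw => simp only [map_add, TensorProduct.add_tmul, hu, hw]
        | tmul u w => simp
    have := e1 (Coalgebra.comul (R := ℂ) a)
    rw [e2, h, ← LinearMap.lTensor_comp_apply] at this
    exact this⟩

lemma iL_ofPointDerivation (ξ : A →ₗ[ℂ] ℂ) (hξ) (f : A) :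
    iL (ofPointDerivation ξ hξ) f =
      TensorProduct.rid ℂ A (ξ.lTensor A (Coalgebra.comul (R := ℂ) f)) := rfl

lemma frameMap_surjective [Algebra.FiniteType ℂ A] : Function.Surjective (frameMap A) := by
  intro D
  let φ : A →ₗ[ℂ] A := LinearMap.mul' ℂ A ∘ₗ
    TensorProduct.map (HopfAlgebra.antipode ℂ) (D : A →ₗ[ℂ] A) ∘ₗ Coalgebra.comul
  have hφ (f g : A) : φ (f * g) =
      Coalgebra.counit (R := ℂ) f • φ g + Coalgebra.counit (R := ℂ) g • φ f := by
    have key (p q : A ⊗[ℂ] A) :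
        LinearMap.mul' ℂ A (TensorProduct.map (HopfAlgebra.antipode ℂ) (D : A →ₗ[ℂ] A) (p * q)) =
        LinearMap.mul' ℂ A ((HopfAlgebra.antipode ℂ).rTensor A p) *
          LinearMap.mul' ℂ A (TensorProduct.map (HopfAlgebra.antipode ℂ) (D : A →ₗ[ℂ] A) q) +
        LinearMap.mul' ℂ A ((HopfAlgebra.antipode ℂ).rTensor A q) *
          LinearMap.mul' ℂ A (TensorProduct.map (HopfAlgebra.antipode ℂ) (D : A →ₗ[ℂ] A) p) := by
      induction p with
      | zero => simp
      | add p p' hp hp' => simp only [add_mul, map_add, hp, hp', mul_add]; ring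
      | tmul a b =>
        induction q with
        | zero => simp
        | add q q' hq hq' => simp only [add_mul, map_add, hq, hq', mul_add]; ring
        | tmul c d =>
          simp [HopfAlgebra.antipode_mul_distrib]
          ring
    have := key (Coalgebra.comul (R := ℂ) f) (Coalgebra.comul (R := ℂ) g)
    rw [← Bialgebra.comul_mul, HopfAlgebra.mul_antipode_rTensor_comul_apply,
      HopfAlgebra.mul_antipode_rTensor_comul_apply, ← Algebra.smul_def, ← Algebra.smul_def] at this
    exact this
  have hD (f : A) : D f = LinearMap.mul' ℂ A (φ.lTensor A (Coalgebra.comul (R := ℂ) f)) := by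
    have e1 (t : A ⊗[ℂ] A) : LinearMap.mul' ℂ A (φ.lTensor A t) =
        LinearMap.mul' ℂ A ((LinearMap.mul' ℂ A ∘ₗ
          TensorProduct.map (HopfAlgebra.antipode ℂ) (D : A →ₗ[ℂ] A)).lTensor A
          ((Coalgebra.comul (R := ℂ)).lTensor A t)) := by
      rw [← LinearMap.comp_apply (LinearMap.lTensor _ _), ← LinearMap.lTensor_comp]; rfl
    have e2 (t : (A ⊗[ℂ] A) ⊗[ℂ] A) : LinearMap.mul' ℂ A ((LinearMap.mul' ℂ A ∘ₗ
          TensorProduct.map (HopfAlgebra.antipode ℂ) (D : A →ₗ[ℂ] A)).lTensor A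
          (TensorProduct.assoc ℂ A A A t)) =
        LinearMap.mul' ℂ A (TensorProduct.map (LinearMap.mul' ℂ A ∘ₗ
          (HopfAlgebra.antipode ℂ).lTensor A) (D : A →ₗ[ℂ] A) t) := by
      induction t with
      | zero => simp
      | add u v hu hv => simp only [map_add, hu, hv]
      | tmul u v =>
        induction u with
        | zero => simp
        | add u w hu hw => simp only [map_add, TensorProduct.add_tmul, hu, hw]
        | tmul u w => simp [mul_assoc]
    have e3 (t : A ⊗[ℂ] A) : LinearMap.mul' ℂ A (TensorProduct.map (LinearMap.mul' ℂ A ∘ₗ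
          (HopfAlgebra.antipode ℂ).lTensor A) (D : A →ₗ[ℂ] A)
          ((Coalgebra.comul (R := ℂ)).rTensor A t)) =
        D (TensorProduct.lid ℂ A ((Coalgebra.counit (R := ℂ)).rTensor A t)) := by
      induction t with
      | zero => simp
      | add u v hu hv => simp only [map_add, hu, hv]
      | tmul u v => simp [Algebra.smul_def]
    rw [e1, ← Coalgebra.coassoc_apply, e2, e3, Coalgebra.rTensor_counit_comul]
    simp
  let b := Module.Basis.ofVectorSpace ℂ A
  let ξ (i) : A →ₗ[ℂ] ℂ := b.coord i ∘ₗ φ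
  have hξ (i) (f g : A) : ξ i (f * g) =
      Coalgebra.counit (R := ℂ) f * ξ i g + Coalgebra.counit (R := ℂ) g * ξ i f := by
    simp only [ξ, LinearMap.comp_apply, hφ, map_add, map_smul, smul_eq_mul]
  obtain ⟨S, hS⟩ := (Algebra.FiniteType.out : (⊤ : Subalgebra ℂ A).FG)
  classical
  let F := S.biUnion fun s ↦ (b.repr (φ s)).support
  have hF (i) (hi : i ∉ F) : ξ i = 0 := by
    refine LinearMap.ext fun f ↦ ?_
    have hf : f ∈ Algebra.adjoin ℂ (S : Set A) := by rw [hS]; trivial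
    induction hf using Algebra.adjoin_induction with
    | mem x hx =>
      by_contra h
      exact hi (Finset.mem_biUnion.2 ⟨x, hx, Finsupp.mem_support_iff.2 h⟩)
    | algebraMap r =>
      have h1 := hξ i 1 1
      rw [mul_one, Bialgebra.counit_one, one_mul] at h1
      have h2 : ξ i 1 = 0 := by simpa using h1
      rw [Algebra.algebraMap_eq_smul_one, map_smul, h2, smul_zero, LinearMap.zero_apply]
    | add x y _ _ hx hy => rw [map_add, hx, hy]; simp
    | mul x y _ _ hx hy => rw [hξ, hx, hy]; simp
  have hsum (f : A) : φ f = ∑ i ∈ F, ξ i f • b i := by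
    conv_lhs => rw [← b.linearCombination_repr (φ f), Finsupp.linearCombination_apply]
    refine Finsupp.sum_of_support_subset _ (fun i hi ↦ ?_) _ (by simp)
    by_contra h
    exact Finsupp.mem_support_iff.1 hi (LinearMap.congr_fun (hF i h) f)
  refine ⟨∑ i ∈ F, b i ⊗ₜ ofPointDerivation (ξ i) (hξ i), ?_⟩
  ext f
  rw [hD, map_sum]
  rw [show ∀ G : _ → VectorFields A, (∑ i ∈ F, G i) f = ∑ i ∈ F, G i f from fun G ↦
    (congrFun (map_sum (Derivation.coeFnAddMonoidHom (R := ℂ) (A := A) (M := A)) G F) f).trans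
      (Finset.sum_apply _ _ _)]
  have e (t : A ⊗[ℂ] A) : LinearMap.mul' ℂ A (φ.lTensor A t) =
      ∑ i ∈ F, b i * TensorProduct.rid ℂ A ((ξ i).lTensor A t) := by
    induction t with
    | zero => simp
    | add u v hu hv => simp only [map_add, hu, hv, mul_add, Finset.sum_add_distrib]
    | tmul u v => simp [hsum, Finset.mul_sum, mul_comm]
  rw [e]
  rfl

/-- The trivialisation `A ⊗ 𝔤 ≃ T` of the tangent bundle by left-invariant vector fields. -/
def frame (A : Type u) [CommRing A] [HopfAlgebra ℂ A] [Algebra.FiniteType ℂ A] :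
    A ⊗[ℂ] LieAlg A ≃ₗ[A] VectorFields A :=
  LinearEquiv.ofBijective (frameMap A) ⟨frameMap_injective, frameMap_surjective⟩

@[simp] lemma frame_tmul [Algebra.FiniteType ℂ A] (a : A) (x : LieAlg A) :
    frame A (a ⊗ₜ x) = a • iL x := rfl

end Frame

section Algebroid

variable (A : Type u) [CommRing A] [Algebra ℂ A]

/-- `1`-forms on the smooth affine variety `Spec A`: `Ω = Hom_A(T, A)`. -/
abbrev Forms : Type u := Module.Dual A (VectorFields A)

variable {A}

/-- The de Rham differential `a ↦ da`, `⟨τ, da⟩ = τ(a)`. -/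
def dR : A →ₗ[ℂ] Forms A where
  toFun a :=
    { toFun := fun τ ↦ τ a
      map_add' := fun _ _ ↦ rfl
      map_smul' := fun _ _ ↦ rfl }
  map_add' a b := by ext τ; simp
  map_smul' c a := by ext τ; simp

@[simp] lemma dR_apply (a : A) (τ : VectorFields A) : dR a τ = τ a := rfl

lemma lie_smul_vectorField (a : A) (τ σ : VectorFields A) : ⁅τ, a • σ⁆ = a • ⁅τ, σ⁆ + τ a • σ := by
  ext b
  simp [Derivation.commutator_apply]

/-- The Lie derivative of `1`-forms: `⟨σ, τ(ω)⟩ = τ⟨σ, ω⟩ - ⟨[τ, σ], ω⟩`. -/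
def lieDer (τ : VectorFields A) : Forms A →ₗ[ℂ] Forms A where
  toFun ω :=
    { toFun := fun σ ↦ τ (ω σ) - ω ⁅τ, σ⁆
      map_add' := fun σ σ' ↦ by simp; ring
      map_smul' := fun a σ ↦ by simp; ring }
  map_add' ω ω' := by ext σ; simp; ring
  map_smul' c ω := by ext σ; simp [smul_sub]

@[simp] lemma lieDer_apply (τ σ : VectorFields A) (ω : Forms A) :
    lieDer τ ω σ = τ (ω σ) - ω ⁅τ, σ⁆ := rfl

variable (A) in
/-- A vertex `A`-algebroid `(A, T, Ω, ∂, γ, ⟨,⟩, c)` whose underlying extended Lie algebroid is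
`(A, Der A, Ω¹, d)`. The symmetric pairing on `T ⊕ Ω` is given by `pair` on `T × T`, by evaluation
on `T × Ω` and by zero on `Ω × Ω`. -/
structure VertexAlgebroid where
  /-- The operation `γ : A × T → Ω`. -/
  γ : A →ₗ[ℂ] VectorFields A →ₗ[ℂ] Forms A
  /-- The pairing `⟨,⟩ : T × T → A`. -/
  pair : VectorFields A →ₗ[ℂ] VectorFields A →ₗ[ℂ] A
  /-- The operation `c : T × T → Ω`. -/
  c : VectorFields A →ₗ[ℂ] VectorFields A →ₗ[ℂ] Forms A
  pair_symm : ∀ τ₁ τ₂, pair τ₁ τ₂ = pair τ₂ τ₁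
  c_skew : ∀ τ₁ τ₂, c τ₁ τ₂ = - c τ₂ τ₁
  γ_smul : ∀ a b τ, γ a (b • τ) = γ (a * b) τ - a • γ b τ - τ a • dR b - τ b • dR a
  pair_smul : ∀ a τ₁ τ₂, pair (a • τ₁) τ₂ = a * pair τ₁ τ₂ + γ a τ₁ τ₂ - τ₁ (τ₂ a)
  c_smul : ∀ a τ₁ τ₂, c (a • τ₁) τ₂ = a • c τ₁ τ₂ + γ a ⁅τ₁, τ₂⁆ - γ (τ₂ a) τ₁
    + lieDer τ₂ (γ a τ₁) - (1 / 2 : ℂ) • (pair τ₁ τ₂ • dR a)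
    + (1 / 2 : ℂ) • dR (τ₁ (τ₂ a)) - (1 / 2 : ℂ) • dR (γ a τ₁ τ₂)
  pair_lie : ∀ τ₁ τ₂ τ₃, pair ⁅τ₁, τ₂⁆ τ₃ + pair τ₂ ⁅τ₁, τ₃⁆ =
    τ₁ (pair τ₂ τ₃) - (1 / 2 : ℂ) • τ₂ (pair τ₁ τ₃) - (1 / 2 : ℂ) • τ₃ (pair τ₁ τ₂)
    + c τ₁ τ₃ τ₂ + c τ₁ τ₂ τ₃
  c_cocycle : ∀ τ₁ τ₂ τ₃,
    lieDer τ₁ (c τ₂ τ₃) - lieDer τ₂ (c τ₁ τ₃) + lieDer τ₃ (c τ₁ τ₂)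
      - c ⁅τ₁, τ₂⁆ τ₃ + c ⁅τ₁, τ₃⁆ τ₂ - c ⁅τ₂, τ₃⁆ τ₁ =
    - (1 / 2 : ℂ) • dR (pair ⁅τ₁, τ₂⁆ τ₃ + pair ⁅τ₁, τ₃⁆ τ₂ - pair ⁅τ₂, τ₃⁆ τ₁
      - τ₁ (pair τ₂ τ₃) + τ₂ (pair τ₁ τ₃) - (2 : ℂ) • c τ₁ τ₂ τ₃)

end Algebroid

section Pushout

variable {A : Type u} [CommRing A] [HopfAlgebra ℂ A]

-- The operations `γ`, `⟨,⟩` and `c` of the vertex algebroid of a group, first as bilinear maps on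
-- `A ⊗ 𝔤 ≃ T`. Below, `a`, `b` are functions and `x`, `y` are left-invariant vector fields.

/-- `γ(a, b x) = - x(a) db - x(b) da`. -/
def frameγ' (a : A) : A ⊗[ℂ] LieAlg A →ₗ[ℂ] Forms A :=
  TensorProduct.lift (LinearMap.mk₂ ℂ (fun b x ↦ - (iL x a • dR b) - iL x b • dR a)
    (by intros; ext; simp; ring) (by intros; ext; simp [Algebra.smul_def]; ring)
    (by intros; ext; simp; ring) (by intros; ext; simp [Algebra.smul_def]; ring))

/-- `γ(a, b x) = - x(a) db - x(b) da`. -/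
def frameγ : A →ₗ[ℂ] A ⊗[ℂ] LieAlg A →ₗ[ℂ] Forms A where
  toFun := frameγ'
  map_add' a b := by
    refine TensorProduct.ext' fun e x ↦ ?_
    ext; simp [frameγ']; ring
  map_smul' r b := by
    refine TensorProduct.ext' fun e x ↦ ?_
    ext; simp [frameγ', Algebra.smul_def]; ring

variable (B : LinearMap.BilinForm ℂ (LieAlg A))

/-- `⟨a x, b y⟩ = ab B(x, y) - a y(x(b)) - b x(y(a)) - x(b) y(a)`. -/
def framePair' (a : A) (x : LieAlg A) : A ⊗[ℂ] LieAlg A →ₗ[ℂ] A :=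
  TensorProduct.lift (LinearMap.mk₂ ℂ (fun b y ↦
      B x y • (a * b) - a * iL y (iL x b) - b * iL x (iL y a) - iL x b * iL y a)
    (by intros; simp [Algebra.smul_def]; ring) (by intros; simp [Algebra.smul_def]; ring)
    (by intros; simp [Algebra.smul_def]; ring) (by intros; simp [Algebra.smul_def]; ring))

/-- `⟨a x, b y⟩ = ab B(x, y) - a y(x(b)) - b x(y(a)) - x(b) y(a)`. -/
def framePair : A ⊗[ℂ] LieAlg A →ₗ[ℂ] A ⊗[ℂ] LieAlg A →ₗ[ℂ] A :=
  TensorProduct.lift (LinearMap.mk₂ ℂ (framePair' B)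
    (by intros; refine TensorProduct.ext' fun e x ↦ ?_; simp [framePair', Algebra.smul_def]; ring)
    (by intros; refine TensorProduct.ext' fun e x ↦ ?_; simp [framePair', Algebra.smul_def]; ring)
    (by intros; refine TensorProduct.ext' fun e x ↦ ?_; simp [framePair', Algebra.smul_def]; ring)
    (by intros; refine TensorProduct.ext' fun e x ↦ ?_; simp [framePair', Algebra.smul_def]; ring))

/-- Twice `c`: `2c(a x, b y) = B(x, y)(a db - b da) + b d(x(y(a))) - a d(y(x(b))) + x(b) d(y(a))
- y(a) d(x(b)) + (2y(x(a)) - x(y(a))) db - (2x(y(b)) - y(x(b))) da`. -/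
def frameC₂' (a : A) (x : LieAlg A) : A ⊗[ℂ] LieAlg A →ₗ[ℂ] Forms A :=
  TensorProduct.lift (LinearMap.mk₂ ℂ (fun b y ↦
      B x y • (a • dR b - b • dR a) + b • dR (iL x (iL y a)) - a • dR (iL y (iL x b))
        + iL x b • dR (iL y a) - iL y a • dR (iL x b)
        + (2 * iL y (iL x a) - iL x (iL y a)) • dR b - (2 * iL x (iL y b) - iL y (iL x b)) • dR a)
    (by intros; ext; simp [Algebra.smul_def]; ring) (by intros; ext; simp [Algebra.smul_def]; ring)
    (by intros; ext; simp [Algebra.smul_def]; ring) (by intros; ext; simp [Algebra.smul_def]; ring))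

/-- Twice `c`: `2c(a x, b y) = B(x, y)(a db - b da) + b d(x(y(a))) - a d(y(x(b))) + x(b) d(y(a))
- y(a) d(x(b)) + (2y(x(a)) - x(y(a))) db - (2x(y(b)) - y(x(b))) da`. -/
def frameC₂ : A ⊗[ℂ] LieAlg A →ₗ[ℂ] A ⊗[ℂ] LieAlg A →ₗ[ℂ] Forms A :=
  TensorProduct.lift (LinearMap.mk₂ ℂ (frameC₂' B)
    (by intros; refine TensorProduct.ext' fun e x ↦ ?_; ext; simp [frameC₂', Algebra.smul_def]; ring)
    (by intros; refine TensorProduct.ext' fun e x ↦ ?_; ext; simp [frameC₂', Algebra.smul_def]; ring)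
    (by intros; refine TensorProduct.ext' fun e x ↦ ?_; ext; simp [frameC₂', Algebra.smul_def]; ring)
    (by intros; refine TensorProduct.ext' fun e x ↦ ?_; ext; simp [frameC₂', Algebra.smul_def]; ring))

lemma iL_lie_apply (x y : LieAlg A) (a : A) :
    iL ⁅x, y⁆ a = iL x (iL y a) - iL y (iL x a) := rfl

lemma iL_lie_iL (x y : LieAlg A) : ⁅iL x, iL y⁆ = iL ⁅x, y⁆ := rfl

lemma lie_frame (a b : A) (x y : LieAlg A) : ⁅a • iL x, b • iL y⁆ =
    (a * iL x b) • iL y - (b * iL y a) • iL x + (a * b) • iL ⁅x, y⁆ := by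
  ext e
  simp [Derivation.commutator_apply, iL_lie_apply, -LieHom.map_lie]
  ring

lemma lie_frame' (a : A) (x y : LieAlg A) : ⁅a • iL x, iL y⁆ =
    - (iL y a • iL x) + a • iL ⁅x, y⁆ := by
  ext e
  simp [Derivation.commutator_apply, iL_lie_apply, -LieHom.map_lie]
  ring

lemma lieDer_add (τ σ : VectorFields A) (ω : Forms A) :
    lieDer (τ + σ) ω = lieDer τ ω + lieDer σ ω := by
  ext; simp; ring

variable [Algebra.FiniteType ℂ A]

/-- The operation `γ` of the vertex algebroid of the group. -/
def groupγ : A →ₗ[ℂ] VectorFields A →ₗ[ℂ] Forms A :=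
  frameγ.compl₂ ((frame A).symm.restrictScalars ℂ).toLinearMap

/-- The pairing on `T × T` of the vertex algebroid of the group. -/
def groupPair : VectorFields A →ₗ[ℂ] VectorFields A →ₗ[ℂ] A :=
  (framePair B).compl₁₂ ((frame A).symm.restrictScalars ℂ).toLinearMap
    ((frame A).symm.restrictScalars ℂ).toLinearMap

/-- Twice the operation `c` of the vertex algebroid of the group. -/
def groupC₂ : VectorFields A →ₗ[ℂ] VectorFields A →ₗ[ℂ] Forms A :=
  (frameC₂ B).compl₁₂ ((frame A).symm.restrictScalars ℂ).toLinearMap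
    ((frame A).symm.restrictScalars ℂ).toLinearMap

lemma frame_symm (a : A) (x : LieAlg A) : (frame A).symm (a • iL x) = a ⊗ₜ x := by
  rw [LinearEquiv.symm_apply_eq, frame_tmul]

lemma groupγ_apply (a b : A) (x : LieAlg A) :
    groupγ a (b • iL x) = - (iL x a • dR b) - iL x b • dR a := by
  change frameγ a ((frame A).symm (b • iL x)) = _
  rw [frame_symm]; simp [frameγ, frameγ']

lemma groupPair_apply (a b : A) (x y : LieAlg A) : groupPair B (a • iL x) (b • iL y) =
    B x y • (a * b) - a * iL y (iL x b) - b * iL x (iL y a) - iL x b * iL y a := by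
  change framePair B ((frame A).symm (a • iL x)) ((frame A).symm (b • iL y)) = _
  rw [frame_symm, frame_symm]; simp [framePair, framePair']

lemma groupC₂_apply (a b : A) (x y : LieAlg A) : groupC₂ B (a • iL x) (b • iL y) =
    B x y • (a • dR b - b • dR a) + b • dR (iL x (iL y a)) - a • dR (iL y (iL x b))
      + iL x b • dR (iL y a) - iL y a • dR (iL x b)
      + (2 * iL y (iL x a) - iL x (iL y a)) • dR b
      - (2 * iL x (iL y b) - iL y (iL x b)) • dR a := by
  change frameC₂ B ((frame A).symm (a • iL x)) ((frame A).symm (b • iL y)) = _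
  rw [frame_symm, frame_symm]; simp [frameC₂, frameC₂']

lemma frame_induction {P : VectorFields A → Prop} (add : ∀ τ σ, P τ → P σ → P (τ + σ))
    (smul : ∀ (a : A) (x : LieAlg A), P (a • iL x)) (τ : VectorFields A) : P τ := by
  obtain ⟨z, rfl⟩ := (frame A).surjective τ
  induction z with
  | zero => simpa using smul 0 0
  | add x y hx hy => rw [map_add]; exact add _ _ hx hy
  | tmul a x => exact smul a x

lemma forms_ext {ω ω' : Forms A} (h : ∀ x : LieAlg A, ω (iL x) = ω' (iL x)) : ω = ω' := by
  ext τ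
  induction τ using frame_induction with
  | add τ σ hτ hσ => rw [map_add, map_add, hτ, hσ]
  | smul a x => rw [map_smul, map_smul, h]

set_option maxHeartbeats 1000000 in
lemma groupC₂_cocycle (hsymm : B.IsSymm) (hinv : B.lieInvariant (LieAlg A)) (a b e : A)
    (x y z : LieAlg A) (τ₁ τ₂ τ₃ : VectorFields A)
    (h₁ : τ₁ = a • iL x) (h₂ : τ₂ = b • iL y) (h₃ : τ₃ = e • iL z) :
    lieDer τ₁ (groupC₂ B τ₂ τ₃) - lieDer τ₂ (groupC₂ B τ₁ τ₃) + lieDer τ₃ (groupC₂ B τ₁ τ₂)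
      - groupC₂ B ⁅τ₁, τ₂⁆ τ₃ + groupC₂ B ⁅τ₁, τ₃⁆ τ₂ - groupC₂ B ⁅τ₂, τ₃⁆ τ₁ =
    - dR (groupPair B ⁅τ₁, τ₂⁆ τ₃ + groupPair B ⁅τ₁, τ₃⁆ τ₂ - groupPair B ⁅τ₂, τ₃⁆ τ₁
      - τ₁ (groupPair B τ₂ τ₃) + τ₂ (groupPair B τ₁ τ₃) - groupC₂ B τ₁ τ₂ τ₃) := by
  refine forms_ext fun w ↦ ?_
  subst h₁ h₂ h₃
  have h1 : B y ⁅x, z⁆ = - B ⁅x, y⁆ z := by rw [hinv x y z, neg_neg]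
  have h2 : B ⁅x, z⁆ y = - B ⁅x, y⁆ z := by rw [hsymm.eq, h1]
  have h3 : B ⁅y, z⁆ x = B ⁅x, y⁆ z := by
    rw [hinv y z x, ← lie_skew, map_neg, neg_neg, hsymm.eq]
  have s1 : B y x = B x y := hsymm.eq _ _
  have s2 : B z x = B x z := hsymm.eq _ _
  have s3 : B z y = B y z := hsymm.eq _ _
  have t1 (v : LieAlg A) : iL v (2 : A) = 0 := (iL v).map_natCast 2
  simp only [lie_frame, map_add, map_sub, groupPair_apply, groupC₂_apply, LinearMap.add_apply,
    LinearMap.sub_apply, LinearMap.neg_apply, LinearMap.smul_apply, lieDer_apply, dR_apply,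
    lie_frame', iL_lie_apply, h2, h3, s1, s2, s3, map_smul, smul_eq_mul, Derivation.smul_apply,
    Derivation.leibniz, Derivation.map_smul_of_tower, map_neg, t1, mul_zero]
  simp only [Algebra.smul_def, map_neg]
  ring

lemma groupC₂_smul (a : A) (τ₁ τ₂ : VectorFields A) : groupC₂ B (a • τ₁) τ₂ = a • groupC₂ B τ₁ τ₂
    + (groupγ a ⁅τ₁, τ₂⁆ + groupγ a ⁅τ₁, τ₂⁆) - (groupγ (τ₂ a) τ₁ + groupγ (τ₂ a) τ₁)
    + (lieDer τ₂ (groupγ a τ₁) + lieDer τ₂ (groupγ a τ₁)) - groupPair B τ₁ τ₂ • dR a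
    + dR (τ₁ (τ₂ a)) - dR (groupγ a τ₁ τ₂) := by
  induction τ₁ using frame_induction with
  | add τ σ hτ hσ =>
    simp only [map_add, smul_add, hτ, hσ, Derivation.add_apply, LinearMap.add_apply, add_lie,
      add_smul]; abel
  | smul b x =>
  induction τ₂ using frame_induction with
  | add τ σ hτ hσ =>
    simp only [map_add, hτ, hσ, Derivation.add_apply, lie_add, smul_add, add_smul, lieDer_add,
      LinearMap.add_apply]; abel
  | smul e y =>
  refine forms_ext fun w ↦ ?_
  rw [lie_frame, smul_smul, groupC₂_apply, groupC₂_apply]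
  simp only [map_add, map_sub, groupγ_apply, groupPair_apply]
  simp [lie_frame', iL_lie_apply, -LieHom.map_lie, Algebra.smul_def]
  ring

lemma groupPair_lie (hsymm : B.IsSymm) (hinv : B.lieInvariant (LieAlg A)) (τ₁ τ₂ τ₃ : VectorFields A) :
    2 * (groupPair B ⁅τ₁, τ₂⁆ τ₃ + groupPair B τ₂ ⁅τ₁, τ₃⁆) =
      2 * τ₁ (groupPair B τ₂ τ₃) - τ₂ (groupPair B τ₁ τ₃) - τ₃ (groupPair B τ₁ τ₂)
      + groupC₂ B τ₁ τ₃ τ₂ + groupC₂ B τ₁ τ₂ τ₃ := by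
  induction τ₁ using frame_induction with
  | add τ σ hτ hσ =>
    simp only [add_lie, map_add, LinearMap.add_apply, Derivation.add_apply]
    linear_combination hτ + hσ
  | smul a x =>
  induction τ₂ using frame_induction with
  | add τ σ hτ hσ =>
    simp only [lie_add, map_add, LinearMap.add_apply, Derivation.add_apply]
    linear_combination hτ + hσ
  | smul b y =>
  induction τ₃ using frame_induction with
  | add τ σ hτ hσ =>
    simp only [lie_add, map_add, LinearMap.add_apply, Derivation.add_apply]
    linear_combination hτ + hσ
  | smul e z =>
  have h1 : B y ⁅x, z⁆ = - B ⁅x, y⁆ z := by rw [hinv x y z, neg_neg]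
  have h2 : B y x = B x y := hsymm.eq _ _
  simp only [lie_frame, map_add, map_sub, groupPair_apply, groupC₂_apply, LinearMap.add_apply,
    LinearMap.sub_apply]
  simp [iL_lie_apply, -LieHom.map_lie, h1, h2, Algebra.smul_def]
  ring

/-- The vertex `A`-algebroid of `G = Spec A` at the level `B`: the push-out along `ℂ → A` of the
vertex algebroid `(ℂ, 𝔤, 𝔤*, 0, 0, B, 0)`, where `𝔤` acts on `A` by left-invariant vector fields.
It is the vertex algebroid with `γ(a, x) = 0`, `⟨x, y⟩ = B(x, y)` and `c(x, y) = 0` for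
left-invariant `x`, `y`; as these span `T` over `A`, the rules for `γ(a, bτ)`, `⟨aτ₁, τ₂⟩` and
`c(aτ₁, τ₂)` determine it. -/
def groupAlgebroid (hsymm : B.IsSymm) (hinv : B.lieInvariant (LieAlg A)) : VertexAlgebroid A where
  γ := groupγ
  pair := groupPair B
  c := (1 / 2 : ℂ) • groupC₂ B
  pair_symm τ₁ τ₂ := by
    induction τ₁ using frame_induction with
    | add τ σ hτ hσ => simp only [map_add, LinearMap.add_apply, hτ, hσ]
    | smul a x =>
    induction τ₂ using frame_induction with
    | add τ σ hτ hσ => simp only [map_add, LinearMap.add_apply, hτ, hσ]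
    | smul b y =>
    rw [groupPair_apply, groupPair_apply, hsymm.eq y x]
    simp [Algebra.smul_def]; ring
  c_skew τ₁ τ₂ := by
    rw [LinearMap.smul_apply, LinearMap.smul_apply, LinearMap.smul_apply, LinearMap.smul_apply,
      ← smul_neg]
    congr 1
    induction τ₁ using frame_induction with
    | add τ σ hτ hσ => simp only [map_add, LinearMap.add_apply, hτ, hσ, neg_add]
    | smul a x =>
    induction τ₂ using frame_induction with
    | add τ σ hτ hσ => simp only [map_add, LinearMap.add_apply, hτ, hσ, neg_add]
    | smul b y =>
    rw [groupC₂_apply, groupC₂_apply, hsymm.eq y x]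
    ext; simp [Algebra.smul_def]; ring
  γ_smul a b τ := by
    induction τ using frame_induction with
    | add τ σ hτ hσ =>
      simp only [map_add, smul_add, hτ, hσ, Derivation.add_apply, add_smul]; abel
    | smul e x =>
    rw [smul_smul, groupγ_apply, groupγ_apply, groupγ_apply]
    ext; simp; ring
  pair_smul a τ₁ τ₂ := by
    induction τ₁ using frame_induction with
    | add τ σ hτ hσ =>
      simp only [map_add, smul_add, hτ, hσ, Derivation.add_apply, LinearMap.add_apply]; ring
    | smul b x =>
    induction τ₂ using frame_induction with
    | add τ σ hτ hσ =>
      simp only [map_add, hτ, hσ, Derivation.add_apply]; ring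
    | smul e y =>
    rw [smul_smul, groupPair_apply, groupPair_apply, groupγ_apply]
    simp [Algebra.smul_def]; ring
  c_smul a τ₁ τ₂ := by
    rw [LinearMap.smul_apply, LinearMap.smul_apply, LinearMap.smul_apply, LinearMap.smul_apply,
      groupC₂_smul]
    have half (ω : Forms A) : (1 / 2 : ℂ) • ω + (1 / 2 : ℂ) • ω = ω := by module
    simp only [smul_add, smul_sub, half, smul_comm (1 / 2 : ℂ) a]
  pair_lie τ₁ τ₂ τ₃ := by
    have h := congrArg (fun t ↦ (1 / 2 : ℂ) • t) (groupPair_lie B hsymm hinv τ₁ τ₂ τ₃)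
    simp only [two_mul] at h
    simp only [LinearMap.smul_apply]
    linear_combination (norm := module) h
  c_cocycle τ₁ τ₂ τ₃ := by
    have h : lieDer τ₁ (groupC₂ B τ₂ τ₃) - lieDer τ₂ (groupC₂ B τ₁ τ₃) + lieDer τ₃ (groupC₂ B τ₁ τ₂)
      - groupC₂ B ⁅τ₁, τ₂⁆ τ₃ + groupC₂ B ⁅τ₁, τ₃⁆ τ₂ - groupC₂ B ⁅τ₂, τ₃⁆ τ₁ =
    - dR (groupPair B ⁅τ₁, τ₂⁆ τ₃ + groupPair B ⁅τ₁, τ₃⁆ τ₂ - groupPair B ⁅τ₂, τ₃⁆ τ₁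
      - τ₁ (groupPair B τ₂ τ₃) + τ₂ (groupPair B τ₁ τ₃) - groupC₂ B τ₁ τ₂ τ₃) := by
      induction τ₁ using frame_induction with
      | add τ σ hτ hσ =>
        simp only [add_lie, map_add, LinearMap.add_apply, Derivation.add_apply, lieDer_add,
          map_sub] at *
        linear_combination (norm := module) hτ + hσ
      | smul a x =>
      induction τ₂ using frame_induction with
      | add τ σ hτ hσ =>
        simp only [add_lie, lie_add, map_add, LinearMap.add_apply, Derivation.add_apply, lieDer_add,
          map_sub] at *
        linear_combination (norm := module) hτ + hσ
      | smul b y =>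
      induction τ₃ using frame_induction with
      | add τ σ hτ hσ =>
        simp only [lie_add, map_add, LinearMap.add_apply, Derivation.add_apply, lieDer_add,
          map_sub] at *
        linear_combination (norm := module) hτ + hσ
      | smul e z => exact groupC₂_cocycle B hsymm hinv a b e x y z _ _ _ rfl rfl rfl
    have h2 : (2 : ℂ) • ((1 / 2 : ℂ) • groupC₂ B) τ₁ τ₂ τ₃ = groupC₂ B τ₁ τ₂ τ₃ := by
      simp only [LinearMap.smul_apply]; module
    rw [h2]
    simp only [LinearMap.smul_apply, map_smul]
    linear_combination (norm := module) (1 / 2 : ℂ) • h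

lemma groupAlgebroid_γ_iL (hsymm : B.IsSymm) (hinv : B.lieInvariant (LieAlg A)) (a : A)
    (x : LieAlg A) : (groupAlgebroid B hsymm hinv).γ a (iL x) = 0 := by
  have := groupγ_apply a 1 x
  rw [one_smul] at this
  exact this.trans (by ext; simp)

lemma groupAlgebroid_pair_iL (hsymm : B.IsSymm) (hinv : B.lieInvariant (LieAlg A))
    (x y : LieAlg A) :
    (groupAlgebroid B hsymm hinv).pair (iL x) (iL y) = algebraMap ℂ A (B x y) := by
  have := groupPair_apply B 1 1 x y
  rw [one_smul, one_smul] at this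
  exact this.trans (by simp [Algebra.smul_def])

lemma groupAlgebroid_c_iL (hsymm : B.IsSymm) (hinv : B.lieInvariant (LieAlg A))
    (x y : LieAlg A) : (groupAlgebroid B hsymm hinv).c (iL x) (iL y) = 0 := by
  have := groupC₂_apply B 1 1 x y
  rw [one_smul, one_smul] at this
  change (1 / 2 : ℂ) • groupC₂ B (iL x) (iL y) = 0
  rw [this]
  ext; simp

end Pushout

section VertexAlgebra

/-- A vertex algebra over `ℂ`: a space of states with `n`-th products `a₍ₙ₎b` (`n ∈ ℤ`), a vacuum,
and the Borcherds identity. The translation operator is `∂a = a₍₋₂₎𝟏`. -/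
class VertexAlgebra (V : Type u) [AddCommGroup V] [Module ℂ V] where
  /-- The product `a₍ₙ₎b`. -/
  nprod : ℤ → V →ₗ[ℂ] V →ₗ[ℂ] V
  /-- The vacuum vector. -/
  vac : V
  exists_nprod_eq_zero : ∀ a b, ∃ N : ℤ, ∀ n, N ≤ n → nprod n a b = 0
  vac_nprod_neg_one : ∀ a, nprod (-1) vac a = a
  vac_nprod : ∀ n a, n ≠ -1 → nprod n vac a = 0
  nprod_neg_one_vac : ∀ a, nprod (-1) a vac = a
  nprod_vac : ∀ n a, 0 ≤ n → nprod n a vac = 0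
  borcherds : ∀ (p q r : ℤ) (a b c : V),
    ∑ᶠ j : ℕ, Ring.choose p j • nprod (p + q - j) (nprod (r + j) a b) c =
    ∑ᶠ j : ℕ, ((-1) ^ j * Ring.choose r j) • (nprod (p + r - j) a (nprod (q + j) b c) -
      (r.negOnePow : ℤ) • nprod (q + r - j) b (nprod (p + j) a c))

/-- A `ℤ≥0`-graded vertex algebra: `V = ⨁ Vᵢ`, `i ≥ 0`, the vacuum has conformal weight `0` and
`(Vᵢ)₍ₙ₎Vⱼ ⊆ V_{i+j-n-1}`, which is zero if `i + j - n - 1 < 0`. -/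
class GradedVertexAlgebra (V : Type u) [AddCommGroup V] [Module ℂ V] extends VertexAlgebra V where
  /-- The component of conformal weight `i`. -/
  weight : ℕ → Submodule ℂ V
  isInternal : DirectSum.IsInternal weight
  vac_mem : vac ∈ weight 0
  nprod_mem : ∀ (i j k : ℕ) (n : ℤ), (k : ℤ) = i + j - n - 1 →
    ∀ a ∈ weight i, ∀ b ∈ weight j, nprod n a b ∈ weight k
  nprod_eq_zero : ∀ (i j : ℕ) (n : ℤ), (i + j - n - 1 : ℤ) < 0 →
    ∀ a ∈ weight i, ∀ b ∈ weight j, nprod n a b = 0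

open VertexAlgebra GradedVertexAlgebra

/-- Morphisms of graded vertex algebras. -/
structure GradedVertexAlgebra.Hom (V W : Type u) [AddCommGroup V] [Module ℂ V]
    [GradedVertexAlgebra V] [AddCommGroup W] [Module ℂ W] [GradedVertexAlgebra W] extends
    V →ₗ[ℂ] W where
  map_vac : toFun vac = vac
  map_nprod : ∀ n a b, toFun (nprod n a b) = nprod n (toFun a) (toFun b)
  map_weight : ∀ i, ∀ a ∈ weight i, toFun a ∈ weight i

variable {A : Type u} [CommRing A] [Algebra ℂ A]

/-- A morphism of a vertex algebroid `𝒜` to (the vertex algebroid of) a graded vertex algebra `V`: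
linear maps `A → V₀` and `T ⊕ Ω → V₁` compatible with all operations. In particular
`a₍₋₁₎τ = aτ - γ(a, τ)`, `τ₍₁₎τ' = ⟨τ, τ'⟩` and `τ₍₀₎τ' = [τ, τ'] - c(τ, τ') + ½ ∂⟨τ, τ'⟩`. -/
structure VertexAlgebroid.Hom (𝒜 : VertexAlgebroid A) (V : Type u) [AddCommGroup V] [Module ℂ V]
    [GradedVertexAlgebra V] where
  /-- The component `A → V₀`. -/
  f₀ : A →ₗ[ℂ] V
  /-- The component `T ⊕ Ω → V₁`. -/
  f₁ : VectorFields A × Forms A →ₗ[ℂ] V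
  mem₀ : ∀ a, f₀ a ∈ weight (V := V) 0
  mem₁ : ∀ ξ, f₁ ξ ∈ weight (V := V) 1
  map_one : f₀ 1 = vac
  map_mul : ∀ a b, nprod (-1) (f₀ a) (f₀ b) = f₀ (a * b)
  map_smul : ∀ a τ ω, nprod (-1) (f₀ a) (f₁ (τ, ω)) = f₁ (a • τ, a • ω - 𝒜.γ a τ)
  map_d : ∀ a, nprod (-2) (f₀ a) vac = f₁ (0, dR a)
  map_act : ∀ τ ω a, nprod 0 (f₁ (τ, ω)) (f₀ a) = f₀ (τ a)
  map_lie : ∀ τ ω τ' ω', nprod 0 (f₁ (τ, ω)) (f₁ (τ', ω')) =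
    f₁ (⁅τ, τ'⁆, (1 / 2 : ℂ) • dR (𝒜.pair τ τ') - 𝒜.c τ τ' + lieDer τ ω' - lieDer τ' ω +
      dR (ω τ'))
  map_pair : ∀ τ ω τ' ω', nprod 1 (f₁ (τ, ω)) (f₁ (τ', ω')) = f₀ (𝒜.pair τ τ' + ω' τ + ω τ')

/-- `φ : 𝒜 → V` exhibits `V` as an algebra of chiral differential operators with vertex algebroid
`𝒜`: it identifies `A` with `V₀` and `T ⊕ Ω` with `V₁`, so that `𝒜` is the vertex algebroid of `V`,
and `V` is the vertex envelope of `𝒜`, that is, every morphism from `𝒜` to a graded vertex algebra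
extends uniquely to `V`. -/
structure VertexAlgebroid.Hom.IsCDO {𝒜 : VertexAlgebroid A} {V : Type u} [AddCommGroup V]
    [Module ℂ V] [GradedVertexAlgebra V] (φ : 𝒜.Hom V) : Prop where
  injective₀ : Function.Injective φ.f₀
  range₀ : LinearMap.range φ.f₀ = weight 0
  injective₁ : Function.Injective φ.f₁
  range₁ : LinearMap.range φ.f₁ = weight 1
  existsUnique_lift : ∀ (W : Type u) [AddCommGroup W] [Module ℂ W] [GradedVertexAlgebra W]
    (ψ : 𝒜.Hom W), ∃! F : GradedVertexAlgebra.Hom V W,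
      (∀ a, F.toLinearMap (φ.f₀ a) = ψ.f₀ a) ∧ ∀ ξ, F.toLinearMap (φ.f₁ ξ) = ψ.f₁ ξ

/-- The identification `V₁ ≃ T ⊕ Ω`. -/
def VertexAlgebroid.Hom.IsCDO.weightOneEquiv {𝒜 : VertexAlgebroid A} {V : Type u} [AddCommGroup V]
    [Module ℂ V] [GradedVertexAlgebra V] {φ : 𝒜.Hom V} (h : φ.IsCDO) :
    weight (V := V) 1 ≃ₗ[ℂ] VectorFields A × Forms A :=
  ((LinearEquiv.ofInjective φ.f₁ h.injective₁).trans (LinearEquiv.ofEq _ _ h.range₁)).symm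

/-- The canonical projection `V₁ → T`. -/
def VertexAlgebroid.Hom.IsCDO.proj {𝒜 : VertexAlgebroid A} {V : Type u} [AddCommGroup V]
    [Module ℂ V] [GradedVertexAlgebra V] {φ : 𝒜.Hom V} (h : φ.IsCDO) :
    weight (V := V) 1 →ₗ[ℂ] VectorFields A :=
  LinearMap.fst ℂ _ _ ∘ₗ h.weightOneEquiv.toLinearMap

end VertexAlgebra

section Embeddings

open GradedVertexAlgebra

variable {A : Type u} [CommRing A] [HopfAlgebra ℂ A]

/-- The embedding `j_L : 𝔤 → V₁ = T ⊕ Ω`, `x ↦ (i_L(x), 0)`. -/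
def jL {𝒜 : VertexAlgebroid A} {V : Type u} [AddCommGroup V] [Module ℂ V] [GradedVertexAlgebra V]
    (φ : 𝒜.Hom V) : LieAlg A →ₗ[ℂ] weight (V := V) 1 :=
  LinearMap.codRestrict _ (φ.f₁ ∘ₗ LinearMap.inl ℂ _ _ ∘ₗ
    (iL (A := A) : LieAlg A →ₗ[ℂ] VectorFields A)) fun _ ↦ φ.mem₁ _

/-- The dual level `(,)ᵒ = -(,)_Killing - (,)`. -/
def dualLevel (B : LinearMap.BilinForm ℂ (LieAlg A)) : LinearMap.BilinForm ℂ (LieAlg A) :=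
  - killingForm ℂ (LieAlg A) - B

end Embeddings

end ChiralDiffOp

end

open ChiralDiffOp VertexAlgebra GradedVertexAlgebra

noncomputable section

namespace ChiralDiffOp

/-! ### Left- and right-invariant vector fields, and their values at the identity. -/

section Hopf

variable {A : Type u} [CommRing A] [HopfAlgebra ℂ A]

/-! Write a candidate for the right embedding as `(iR x, ω)`. The first product with `(iL z, 0)` is
`⟨iL z, iR x⟩ + ω (iL z)`. Its vanishing for all `z` fixes `ω`, because left-invariant fields span
`T` over `A`; this is uniqueness.

For existence, expand `iR x = ∑ fᵢ bᵢ` in a left-invariant frame. Since left- and right-invariant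
fields commute, the derivatives of the `fᵢ` are given by structure constants: `y(fᵢ) = -∑ₖ [y, bₖ]ⁱ
fₖ`. The pairing with `iL z` contains the second-order term `-∑ bᵢ(z(fᵢ))`, in which two structure
constants are contracted into a trace `tr(ad ad)`. This is the source of the Killing form: `⟨iL z,
iR x⟩ = ∑ (B + K)(z, bₖ) fₖ`, so that `ω` must be the contraction of `iR x` with the dual level. The
zeroth product then vanishes as well: the brackets commute, `c(iL z, τ) = ½ d⟨iL z, τ⟩` for every
`τ`, and `ω` is invariant because the dual level is. Higher products vanish by weight.

For the level, the same contraction gives `⟨iR x, iR y⟩ = -(x, y)ᵒ`, while each of the two cross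
terms gives `(x, y)ᵒ`. Here an invariant form of two right-invariant fields is killed by every
left-invariant field, hence is constant by connectedness (`eq_algebraMap_counit`), and is evaluated
at the identity. The zeroth product of two right embeddings needs no computation of `c`: it again
commutes with the left embedding, so the uniqueness argument identifies it from its projection to
`T`. -/

lemma comul_injective : Function.Injective (Coalgebra.comul (R := ℂ) (A := A)) := by
  refine Function.LeftInverse.injective (g := fun t ↦
    TensorProduct.rid ℂ A ((Coalgebra.counit (R := ℂ)).lTensor A t)) fun a ↦ ?_
  simp

/-- This is `(gh)⁻¹ = h⁻¹g⁻¹` on functor-of-points level. In the convolution group of algebra maps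
`A → A ⊗ A`, the comultiplication is the product of the two inclusions, and inversion is
precomposition with the antipode. -/
lemma comul_antipode (f : A) : Coalgebra.comul (R := ℂ) (HopfAlgebra.antipode ℂ f) =
    TensorProduct.map (HopfAlgebra.antipode ℂ) (HopfAlgebra.antipode ℂ)
      (TensorProduct.comm ℂ A A (Coalgebra.comul (R := ℂ) f)) := by
  let ι₁ : A →ₐ[ℂ] A ⊗[ℂ] A := Algebra.TensorProduct.includeLeft
  let ι₂ : A →ₐ[ℂ] A ⊗[ℂ] A := Algebra.TensorProduct.includeRight
  have h : WithConv.toConv (Bialgebra.comulAlgHom ℂ A) =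
      WithConv.toConv ι₁ * WithConv.toConv ι₂ := by
    refine WithConv.ext (AlgHom.ext fun c ↦ ?_)
    refine Eq.trans ?_ (AlgHom.convMul_apply _ _ c).symm
    change Coalgebra.comul (R := ℂ) c = _
    generalize Coalgebra.comul (R := ℂ) c = t
    induction t with
    | zero => simp
    | add u v hu hv => rw [map_add, ← hu, ← hv]
    | tmul u v => simp [ι₁, ι₂]
  have h' := congrArg (fun F : WithConv (A →ₐ[ℂ] A ⊗[ℂ] A) ↦ F.ofConv f) (congrArg (·⁻¹) h)
  have hinv : (WithConv.toConv ι₁ * WithConv.toConv ι₂)⁻¹ =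
    (WithConv.toConv ι₂)⁻¹ * (WithConv.toConv ι₁)⁻¹ :=
    @mul_inv_rev (WithConv (A →ₐ[ℂ] A ⊗[ℂ] A)) AlgHom.convGroup.toDivisionMonoid _ _
  refine Eq.trans h' ((congrArg (fun F : WithConv (A →ₐ[ℂ] A ⊗[ℂ] A) ↦ F.ofConv f) hinv).trans
    ?_)
  refine ((AlgHom.convMul_apply _ _ f).trans ?_)
  generalize Coalgebra.comul (R := ℂ) f = t
  induction t with
  | zero => simp
  | add u v hu hv => simp only [map_add, hu, hv]
  | tmul u v =>
    change Algebra.TensorProduct.lift (ι₂.comp (HopfAlgebra.antipodeAlgHom ℂ A))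
      (ι₁.comp (HopfAlgebra.antipodeAlgHom ℂ A)) _ (u ⊗ₜ v) = _
    simp [ι₁, ι₂]

/-- Right-invariant vector fields are right-invariant: `Δ ∘ D = (D ⊗ id) ∘ Δ`. -/
lemma comul_iR (x : LieAlg A) (f : A) : Coalgebra.comul (R := ℂ) (iR x f) =
    ((iR x : VectorFields A) : A →ₗ[ℂ] A).rTensor A (Coalgebra.comul (R := ℂ) f) := by
  rw [iR_apply, comul_antipode, comul_iL, comul_antipode]
  generalize Coalgebra.comul (R := ℂ) f = t
  induction t with
  | zero => simp
  | add u v hu hv => simp only [map_add, hu, hv]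
  | tmul u v => simp [antipode_antipode, iR_apply]

/-- After applying `Δ`, one field acts on the right tensor factor and the other on the left, so the
order does not matter. -/
lemma lie_iL_iR (x y : LieAlg A) : ⁅(iL x : VectorFields A), (iR y : VectorFields A)⁆ = 0 := by
  ext f
  rw [Derivation.commutator_apply, Derivation.zero_apply, sub_eq_zero]
  refine comul_injective ?_
  rw [comul_iL, comul_iR, comul_iR, comul_iL]
  generalize Coalgebra.comul (R := ℂ) f = t
  induction t with
  | zero => simp
  | add u v hu hv => simp only [map_add, hu, hv]
  | tmul u v => simp

lemma iR_injective : Function.Injective (iR (A := A)) := by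
  intro x y h
  refine Subtype.ext (Derivation.ext fun f ↦ ?_)
  have h1 := congrArg (HopfAlgebra.antipode ℂ)
    (congrArg (fun D : VectorFields A ↦ D (HopfAlgebra.antipode ℂ f)) h)
  simp only [iR_apply, antipode_antipode] at h1
  exact h1

/-- A left-invariant vector field is recovered from its value at the identity. -/
lemma iL_eq_rid (x : LieAlg A) (f : A) : iL x f = TensorProduct.rid ℂ A
    ((Coalgebra.counit (R := ℂ) ∘ₗ ((iL x : VectorFields A) : A →ₗ[ℂ] A)).lTensor A
      (Coalgebra.comul (R := ℂ) f)) := by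
  rw [LinearMap.lTensor_comp, LinearMap.comp_apply, ← comul_iL]
  simp

variable (A) in
/-- The pairing of the Lie algebra with functions: the derivative of a function at the identity. -/
def tangentMap : LieAlg A →ₗ[ℂ] A →ₗ[ℂ] ℂ where
  toFun x := Coalgebra.counit (R := ℂ) ∘ₗ ((iL x : VectorFields A) : A →ₗ[ℂ] A)
  map_add' x y := by ext; simp
  map_smul' c x := by ext; simp

lemma tangentMap_apply (x : LieAlg A) (f : A) :
    tangentMap A x f = Coalgebra.counit (R := ℂ) (iL x f) := rfl

lemma tangentMap_injective : Function.Injective (tangentMap A) := by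
  intro x y h
  refine Subtype.ext (Derivation.ext fun f ↦ ?_)
  refine (iL_eq_rid x f).trans (Eq.trans ?_ (iL_eq_rid y f).symm)
  exact congrArg (fun F : A →ₗ[ℂ] ℂ ↦ TensorProduct.rid ℂ A
    (F.lTensor A (Coalgebra.comul (R := ℂ) f))) h

lemma tangentMap_mul (x : LieAlg A) (f g : A) : tangentMap A x (f * g) =
    Coalgebra.counit (R := ℂ) f * tangentMap A x g +
      Coalgebra.counit (R := ℂ) g * tangentMap A x f := by
  simp [tangentMap_apply]

lemma tangentMap_ofPointDerivation (ξ : A →ₗ[ℂ] ℂ) (hξ) (f : A) :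
    tangentMap A (ofPointDerivation ξ hξ) f = ξ f := by
  rw [tangentMap_apply, iL_ofPointDerivation]
  have h (t : A ⊗[ℂ] A) : Coalgebra.counit (R := ℂ) (TensorProduct.rid ℂ A (ξ.lTensor A t)) =
      ξ (TensorProduct.lid ℂ A ((Coalgebra.counit (R := ℂ)).rTensor A t)) := by
    induction t with
    | zero => simp
    | add u v hu hv => simp only [map_add, hu, hv]
    | tmul u v => simp [mul_comm]
  rw [h, Coalgebra.rTensor_counit_comul]
  simp

/-- Inversion has derivative `-1` at the identity: differentiate the antipode axiom, whose right
side is constant, by the Leibniz rule. -/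
lemma tangentMap_antipode (x : LieAlg A) (f : A) :
    tangentMap A x (HopfAlgebra.antipode ℂ f) = - tangentMap A x f := by
  have h (t : A ⊗[ℂ] A) : tangentMap A x
      (LinearMap.mul' ℂ A ((HopfAlgebra.antipode ℂ).rTensor A t)) =
      tangentMap A x (TensorProduct.lid ℂ A ((Coalgebra.counit (R := ℂ)).rTensor A t)) +
      tangentMap A x (HopfAlgebra.antipode ℂ
        (TensorProduct.rid ℂ A ((Coalgebra.counit (R := ℂ)).lTensor A t))) := by
    induction t with
    | zero => simp
    | add u v hu hv => simp only [map_add, hu, hv]; ring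
    | tmul u v => simp [tangentMap_mul]
  have h1 := h (Coalgebra.comul (R := ℂ) f)
  rw [HopfAlgebra.mul_antipode_rTensor_comul_apply, Coalgebra.rTensor_counit_comul,
    Coalgebra.lTensor_counit_comul] at h1
  have h2 : tangentMap A x (algebraMap ℂ A (Coalgebra.counit (R := ℂ) f)) = 0 := by
    rw [tangentMap_apply, Derivation.map_algebraMap, map_zero]
  rw [h2] at h1
  simp only [TensorProduct.lid_tmul, TensorProduct.rid_tmul, one_smul] at h1
  linear_combination -h1

lemma counit_iR (x : LieAlg A) (f : A) :
    Coalgebra.counit (R := ℂ) (iR x f) = - tangentMap A x f := by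
  rw [iR_apply, HopfAlgebra.counit_antipode, ← tangentMap_apply, tangentMap_antipode]

/-- A tangent vector at the identity is determined by its values on finitely many algebra
generators. -/
instance [Algebra.FiniteType ℂ A] : FiniteDimensional ℂ (LieAlg A) := by
  obtain ⟨S, hS⟩ := (Algebra.FiniteType.out : (⊤ : Subalgebra ℂ A).FG)
  let F : LieAlg A →ₗ[ℂ] (S → ℂ) := LinearMap.pi fun s ↦ (tangentMap A).flip s
  refine Module.Finite.of_injective F ?_
  rw [injective_iff_map_eq_zero]
  intro x hx
  refine tangentMap_injective ?_
  rw [map_zero]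
  refine LinearMap.ext fun f ↦ ?_
  have hf : f ∈ Algebra.adjoin ℂ (S : Set A) := by rw [hS]; trivial
  induction hf using Algebra.adjoin_induction with
  | mem s hs => exact congrFun hx ⟨s, hs⟩
  | algebraMap r => rw [tangentMap_apply, Derivation.map_algebraMap, map_zero]; rfl
  | add f g _ _ hf hg => rw [map_add, hf, hg, map_add]
  | mul f g _ _ hf hg => rw [tangentMap_mul, hf, hg]; simp

end Hopf

/-! ### Functions with zero derivative on a connected group are constant. -/

section Constant

variable {A : Type u} [CommRing A] [HopfAlgebra ℂ A]

variable (A) in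
/-- The maximal ideal of functions vanishing at the identity. -/
abbrev augmentationIdeal : Ideal A := RingHom.ker (Bialgebra.counitAlgHom ℂ A)

lemma mem_augmentationIdeal {f : A} :
    f ∈ augmentationIdeal A ↔ Coalgebra.counit (R := ℂ) f = 0 := Iff.rfl

/-- A function vanishing at the identity together with its differential lies in the square of the
maximal ideal. -/
lemma mem_augmentationIdeal_sq {f : A} (hf : f ∈ augmentationIdeal A)
    (h : ∀ x : LieAlg A, tangentMap A x f = 0) : f ∈ augmentationIdeal A ^ 2 := by
  by_contra hn
  have hn : f ∉ ((augmentationIdeal A) ^ 2).restrictScalars ℂ := hn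
  obtain ⟨ℓ, hℓ, hle⟩ := Submodule.exists_le_ker_of_notMem
    (p := ((augmentationIdeal A) ^ 2).restrictScalars ℂ) (v := f) hn
  -- The functional `a ↦ ℓ (a - ε(a))` is a point derivation because `ℓ` kills the square of the
  -- ideal; it is therefore the value at the identity of a left-invariant field.
  let ξ : A →ₗ[ℂ] ℂ := ℓ - (Algebra.linearMap ℂ A ∘ₗ Coalgebra.counit (R := ℂ)).dualMap ℓ
  have hξa (a : A) : ξ a = ℓ a - ℓ (algebraMap ℂ A (Coalgebra.counit (R := ℂ) a)) := rfl
  have hξ (a b : A) : ξ (a * b) =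
      Coalgebra.counit (R := ℂ) a * ξ b + Coalgebra.counit (R := ℂ) b * ξ a := by
    have hm (a : A) : a - algebraMap ℂ A (Coalgebra.counit (R := ℂ) a) ∈ augmentationIdeal A := by
      rw [mem_augmentationIdeal]; simp
    have h0 : ℓ ((a - algebraMap ℂ A (Coalgebra.counit (R := ℂ) a)) *
        (b - algebraMap ℂ A (Coalgebra.counit (R := ℂ) b))) = 0 := by
      refine hle ?_
      change _ ∈ (augmentationIdeal A) ^ 2
      rw [sq]
      exact Ideal.mul_mem_mul (hm a) (hm b)
    have e (c : ℂ) (g : A) : algebraMap ℂ A c * g = c • g := (Algebra.smul_def c g).symm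
    have e' (c : ℂ) (g : A) : g * algebraMap ℂ A c = c • g := by rw [mul_comm, e]
    simp only [sub_mul, mul_sub, e, e', map_sub, map_smul, smul_eq_mul] at h0
    simp only [hξa, Bialgebra.counit_mul, map_mul, e, map_smul, smul_eq_mul]
    linear_combination h0
  have h1 := h (ofPointDerivation ξ hξ)
  rw [tangentMap_ofPointDerivation, hξa, mem_augmentationIdeal.1 hf] at h1
  exact hℓ (by simpa using h1)

/-- An Euler vector field at the identity. -/
lemma exists_euler [Algebra.FiniteType ℂ A] : ∃ E : VectorFields A,
    (∀ u : A, (∀ x : LieAlg A, iL x u = 0) → E u = 0) ∧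
    ∀ f ∈ augmentationIdeal A, E f - f ∈ augmentationIdeal A ^ 2 := by
  let b := Module.finBasis ℂ (LieAlg A)
  -- Finite-dimensionality makes every covector at the identity a differential. The `t'` below are
  -- functions vanishing there whose differentials are the dual basis, and `E = ∑ t'ᵢ bᵢ`.
  have hs : Function.Surjective (tangentMap A).flip :=
    LinearMap.flip_surjective_iff₁.2 tangentMap_injective
  choose t ht using fun i ↦ hs (b.coord i)
  let t' i := t i - algebraMap ℂ A (Coalgebra.counit (R := ℂ) (t i))
  have ht0 (i) : Coalgebra.counit (R := ℂ) (t' i) = 0 := by simp [t']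
  have ht1 (x i) : tangentMap A x (t' i) = b.repr x i := by
    have h := LinearMap.congr_fun (ht i) x
    have h2 : tangentMap A x (algebraMap ℂ A (Coalgebra.counit (R := ℂ) (t i))) = 0 := by
      rw [tangentMap_apply, Derivation.map_algebraMap, map_zero]
    simp only [t', map_sub, h2, sub_zero]
    exact h
  have hE (f : A) : (∑ i, t' i • iL (b i) : VectorFields A) f = ∑ i, t' i * iL (b i) f := by
    refine (congrFun (map_sum (Derivation.coeFnAddMonoidHom (R := ℂ) (A := A) (M := A))
      (fun i ↦ t' i • iL (b i)) Finset.univ) f).trans ?_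
    exact Finset.sum_apply _ _ _
  refine ⟨∑ i, t' i • iL (b i), fun u hu ↦ ?_, fun f hf ↦ ?_⟩
  · rw [hE]; simp [hu]
  · rw [hE]
    refine mem_augmentationIdeal_sq ?_ fun x ↦ ?_
    · rw [mem_augmentationIdeal] at *
      simp [hf, ht0]
    · rw [map_sub, map_sum]
      simp only [tangentMap_mul, ht0, ht1, zero_mul, zero_add]
      conv_lhs => enter [2]; rw [← b.sum_repr x, map_sum, LinearMap.sum_apply]
      simp only [map_smul, LinearMap.smul_apply, smul_eq_mul, ← tangentMap_apply]
      rw [sub_eq_zero]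
      exact Finset.sum_congr rfl fun _ _ ↦ mul_comm _ _

/-- An Euler vector field for an ideal `I` acts on `Iⁿ / Iⁿ⁺¹` as multiplication by `n`. -/
lemma euler_pow {I : Ideal A} {E : VectorFields A} (hE : ∀ f ∈ I, E f - f ∈ I ^ 2) (n : ℕ) :
    ∀ f ∈ I ^ (n + 1), E f - ((n + 1 : ℕ) : ℂ) • f ∈ I ^ (n + 2) := by
  induction n with
  | zero =>
    intro f hf
    rw [zero_add, pow_one] at hf
    simpa using hE f hf
  | succ n ih =>
    intro f hf
    rw [pow_succ] at hf
    refine Submodule.mul_induction_on hf (fun g hg h hh ↦ ?_) fun g h hg hh ↦ ?_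
    · have e : E (g * h) - ((n + 1 + 1 : ℕ) : ℂ) • (g * h) =
          g * (E h - h) + (E g - ((n + 1 : ℕ) : ℂ) • g) * h := by
        simp [Algebra.smul_def]; ring
      rw [e]
      refine Ideal.add_mem _ ?_ ?_
      · have := Ideal.mul_mem_mul hg (hE h hh)
        rwa [← pow_add] at this
      · rw [pow_succ]
        exact Ideal.mul_mem_mul (ih g hg) hh
    · have e : E (g + h) - ((n + 1 + 1 : ℕ) : ℂ) • (g + h) =
        (E g - ((n + 1 + 1 : ℕ) : ℂ) • g) + (E h - ((n + 1 + 1 : ℕ) : ℂ) • h) := by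
        rw [map_add, smul_add]; abel
      rw [e]
      exact Ideal.add_mem _ hg hh

/-- A function killed by all vector fields and vanishing at the identity vanishes near it. -/
lemma exists_mul_eq_zero [Algebra.FiniteType ℂ A] {u : A} (hu : ∀ x : LieAlg A, iL x u = 0)
    (h0 : Coalgebra.counit (R := ℂ) u = 0) :
    ∃ s : A, Coalgebra.counit (R := ℂ) s = 1 ∧ s * u = 0 := by
  have : IsNoetherianRing A := Algebra.FiniteType.isNoetherianRing ℂ A
  obtain ⟨E, hE0, hE⟩ := exists_euler (A := A)
  -- Since `E u = 0`, while `E` is multiplication by the nonzero scalar `n + 1` modulo the next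
  -- power of the ideal, `u` drops into that next power.
  have key (n : ℕ) : u ∈ augmentationIdeal A ^ (n + 1) := by
    induction n with
    | zero => rw [zero_add, pow_one]; exact h0
    | succ n ih =>
      have h := euler_pow hE n u ih
      rw [hE0 u hu, zero_sub, neg_mem_iff] at h
      have h1 := Submodule.smul_of_tower_mem (augmentationIdeal A ^ (n + 1 + 1))
        (((n + 1 : ℕ) : ℂ)⁻¹) h
      rwa [smul_smul, inv_mul_cancel₀ (Nat.cast_ne_zero.2 n.succ_ne_zero), one_smul] at h1
  -- Krull's intersection theorem: an element of all powers of the ideal is fixed by some `r` in the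
  -- ideal, and `s = 1 - r`.
  have hmem : u ∈ (⨅ i : ℕ, augmentationIdeal A ^ i • ⊤ : Submodule A A) := by
    rw [Submodule.mem_iInf]
    intro i
    rw [smul_eq_mul, Ideal.mul_top]
    exact Ideal.pow_le_pow_right i.le_succ (key i)
  obtain ⟨r, hr⟩ := (Ideal.mem_iInf_smul_pow_eq_bot_iff _ u).1 hmem
  refine ⟨1 - r, ?_, ?_⟩
  · have : Coalgebra.counit (R := ℂ) (r : A) = 0 := r.2
    simp [this]
  · rw [smul_eq_mul] at hr
    rw [sub_mul, one_mul, hr, sub_self]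

/-- Translation of functions by the point `χ`. -/
def translation (χ : A →ₐ[ℂ] ℂ) : A →ₐ[ℂ] A :=
  (Algebra.TensorProduct.lid ℂ A).toAlgHom.comp
    ((Algebra.TensorProduct.map χ (AlgHom.id ℂ A)).comp (Bialgebra.comulAlgHom ℂ A))

lemma translation_apply (χ : A →ₐ[ℂ] ℂ) (f : A) : translation χ f =
    TensorProduct.lid ℂ A (χ.toLinearMap.rTensor A (Coalgebra.comul (R := ℂ) f)) := rfl

/-- Translation acts on the left factor of `Δ`, a left-invariant field on the right one. -/
lemma iL_translation (χ : A →ₐ[ℂ] ℂ) (x : LieAlg A) (f : A) :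
    iL x (translation χ f) = translation χ (iL x f) := by
  rw [translation_apply, translation_apply, comul_iL]
  generalize Coalgebra.comul (R := ℂ) f = t
  induction t with
  | zero => simp
  | add u v hu hv => simp only [map_add, hu, hv]
  | tmul u v => simp

lemma counit_translation (χ : A →ₐ[ℂ] ℂ) (f : A) :
    Coalgebra.counit (R := ℂ) (translation χ f) = χ f := by
  have h (t : A ⊗[ℂ] A) : Coalgebra.counit (R := ℂ)
      (TensorProduct.lid ℂ A (χ.toLinearMap.rTensor A t)) =
      χ (TensorProduct.rid ℂ A ((Coalgebra.counit (R := ℂ)).lTensor A t)) := by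
    induction t with
    | zero => simp
    | add u v hu hv => simp only [map_add, hu, hv]
    | tmul u v => simp [mul_comm]
  rw [translation_apply, h, Coalgebra.lTensor_counit_comul]
  simp

lemma translation_translation (χ χ' : A →ₐ[ℂ] ℂ) (f : A) :
    translation χ (translation χ' f) =
      translation (WithConv.toConv χ' * WithConv.toConv χ).ofConv f := by
  have e1 (t : A ⊗[ℂ] A) : translation χ (TensorProduct.lid ℂ A (χ'.toLinearMap.rTensor A t)) =
      TensorProduct.lid ℂ A (χ'.toLinearMap.rTensor A ((translation χ).toLinearMap.lTensor A t)) := by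
    induction t with
    | zero => simp
    | add u v hu hv => simp only [map_add, hu, hv]
    | tmul u v => simp
  rw [translation_apply χ', e1, translation_apply]
  have e2 (t : A ⊗[ℂ] A) : (translation χ).toLinearMap.lTensor A t =
      ((TensorProduct.lid ℂ A).toLinearMap ∘ₗ χ.toLinearMap.rTensor A).lTensor A
        ((Coalgebra.comul (R := ℂ)).lTensor A t) := by
    rw [← LinearMap.comp_apply (LinearMap.lTensor _ _), ← LinearMap.lTensor_comp]; rfl
  rw [e2, ← Coalgebra.coassoc_apply]
  generalize Coalgebra.comul (R := ℂ) f = t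
  induction t with
  | zero => simp
  | add u v hu hv => simp only [map_add, hu, hv]
  | tmul u v =>
    rw [LinearMap.rTensor_tmul, LinearMap.rTensor_tmul, AlgHom.toLinearMap_apply]
    change _ = TensorProduct.lid ℂ A
      (((WithConv.toConv χ' * WithConv.toConv χ : WithConv (A →ₐ[ℂ] ℂ)) u) ⊗ₜ v)
    rw [AlgHom.convMul_apply]
    generalize Coalgebra.comul (R := ℂ) u = w
    induction w with
    | zero => simp
    | add u v hu hv => simp only [map_add, TensorProduct.add_tmul, hu, hv]
    | tmul u w => simp [smul_smul, mul_comm]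

lemma translation_inv (χ : A →ₐ[ℂ] ℂ) (f : A) :
    translation ((WithConv.toConv χ)⁻¹).ofConv (translation χ f) = f := by
  rw [translation_translation, WithConv.toConv_ofConv, mul_inv_cancel, translation_apply]
  have h : (1 : WithConv (A →ₐ[ℂ] ℂ)).ofConv.toLinearMap = Coalgebra.counit (R := ℂ) := rfl
  rw [h, Coalgebra.rTensor_counit_comul]
  simp

/-- On a connected group, a function killed by all vector fields is constant. -/
lemma eq_algebraMap_counit [Algebra.FiniteType ℂ A] [ConnectedSpace (PrimeSpectrum A)] {u : A}
    (hu : ∀ x : LieAlg A, iL x u = 0) : u = algebraMap ℂ A (Coalgebra.counit (R := ℂ) u) := by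
  set v := u - algebraMap ℂ A (Coalgebra.counit (R := ℂ) u) with hv
  have hv' (x : LieAlg A) : iL x v = 0 := by
    rw [hv, map_sub, hu, Derivation.map_algebraMap, sub_zero]
  have hv0 : Coalgebra.counit (R := ℂ) v = 0 := by simp [hv]
  -- Homogeneity: the local statement at the identity is carried to any point by translating there
  -- and back.
  have key (χ : A →ₐ[ℂ] ℂ) (hχ : χ v = 0) : ∃ s : A, χ s = 1 ∧ s * v = 0 := by
    obtain ⟨s, hs, hsv⟩ := exists_mul_eq_zero (u := translation χ v)
      (fun x ↦ by rw [iL_translation, hv', map_zero]) (by rw [counit_translation, hχ])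
    refine ⟨translation ((WithConv.toConv χ)⁻¹).ofConv s, ?_, ?_⟩
    · rw [← counit_translation, translation_translation, WithConv.toConv_ofConv,
        inv_mul_cancel, counit_translation]
      exact hs
    · rw [← translation_inv χ v, ← map_mul, hsv, map_zero]
  -- At each closed point, either `v` is nonzero or some function nonzero there annihilates `v`. By
  -- the Nullstellensatz these points are all the maximal ideals.
  have htop : Ideal.span {v} ⊔ (Submodule.span A {v}).annihilator = ⊤ := by
    by_contra hne
    obtain ⟨m, hm, hle⟩ := Ideal.exists_le_maximal _ hne
    let _ : Field (A ⧸ m) := Ideal.Quotient.field m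
    have : Module.Finite ℂ (A ⧸ m) := finite_of_finite_type_of_isJacobsonRing ℂ (A ⧸ m)
    let e : ℂ ≃ₐ[ℂ] A ⧸ m := AlgEquiv.ofBijective (Algebra.ofId ℂ (A ⧸ m))
      IsAlgClosed.algebraMap_bijective_of_isIntegral
    let χ : A →ₐ[ℂ] ℂ := e.symm.toAlgHom.comp (Ideal.Quotient.mkₐ ℂ m)
    have hχ (a : A) (ha : a ∈ m) : χ a = 0 := by
      change e.symm (Ideal.Quotient.mk m a) = 0
      rw [Ideal.Quotient.eq_zero_iff_mem.2 ha, map_zero]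
    obtain ⟨s, hs, hsv⟩ := key χ (hχ v (hle (Ideal.mem_sup_left (Ideal.mem_span_singleton_self v))))
    have : s ∈ m := hle (Ideal.mem_sup_right (by
      rwa [Submodule.mem_annihilator_span_singleton, smul_eq_mul]))
    rw [hχ s this] at hs
    exact zero_ne_one hs
  obtain ⟨p, hp, j, hj, hpj⟩ := Submodule.mem_sup.1 ((Ideal.eq_top_iff_one _).1 htop)
  obtain ⟨c, rfl⟩ := Ideal.mem_span_singleton.1 hp
  rw [Submodule.mem_annihilator_span_singleton, smul_eq_mul] at hj
  -- From `v c + j = 1` and `j v = 0`, the element `v c` is idempotent. It vanishes at the identity,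
  -- so connectedness forces it to be zero; then `j = 1` and `v = 0`.
  have hid : IsIdempotentElem (v * c) := by
    change v * c * (v * c) = v * c
    linear_combination (v * c) * hpj - c * hj
  have hclopen : IsClopen (PrimeSpectrum.basicOpen (v * c) : Set (PrimeSpectrum A)) :=
    PrimeSpectrum.isClopen_iff.2 ⟨_, hid, rfl⟩
  have hprime : (augmentationIdeal A).IsPrime := RingHom.ker_isPrime _
  have hvc : v * c = 0 := by
    rcases isClopen_iff.1 hclopen with h | h
    · have h2 : IsNilpotent (v * c) := by
        rw [← PrimeSpectrum.basicOpen_eq_bot_iff]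
        exact TopologicalSpace.Opens.ext h
      obtain ⟨n, hn⟩ := h2
      rcases n with _ | n
      · rw [pow_zero] at hn
        rw [← mul_one (v * c), hn, mul_zero]
      · rwa [hid.pow_succ_eq] at hn
    · have h2 : (⟨_, hprime⟩ : PrimeSpectrum A) ∈
          (PrimeSpectrum.basicOpen (v * c) : Set (PrimeSpectrum A)) := by rw [h]; trivial
      refine absurd ?_ h2
      change Coalgebra.counit (R := ℂ) (v * c) = 0
      rw [Bialgebra.counit_mul, hv0, zero_mul]
  have hj1 : j = 1 := by rw [← hpj, hvc, zero_add]
  rw [hj1, one_mul] at hj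
  exact sub_eq_zero.1 hj

end Constant
-- Contractions of invariant families, and the origin of the Killing form.
section InvariantFamily

variable {A : Type u} [CommRing A] [HopfAlgebra ℂ A] {ι : Type*} [Fintype ι]

/-- The vector field `∑ fᵢ xᵢ` commutes with all left-invariant ones, in coordinates. -/
def IsInvariantFamily (b : Module.Basis ι ℂ (LieAlg A)) (f : ι → A) : Prop :=
  ∀ y i, iL y (f i) = - ∑ k, b.repr ⁅y, b k⁆ i • f k

variable {b : Module.Basis ι ℂ (LieAlg A)} {f g : ι → A}

/-- Basis-free form of the condition: differentiating along `y` is minus the coadjoint shift of the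
functional. -/
lemma IsInvariantFamily.iL_sum (hf : IsInvariantFamily b f) (l : LieAlg A →ₗ[ℂ] ℂ)
    (y : LieAlg A) : iL y (∑ i, l (b i) • f i) = - ∑ i, l ⁅y, b i⁆ • f i := by
  have h (k) : l ⁅y, b k⁆ = ∑ i, b.repr ⁅y, b k⁆ i * l (b i) := by
    conv_lhs => rw [← b.sum_repr ⁅y, b k⁆, map_sum]
    simp
  rw [map_sum]
  simp only [Derivation.map_smul, hf y, h, Finset.sum_smul, smul_neg, Finset.smul_sum,
    Finset.sum_neg_distrib, smul_smul]
  rw [Finset.sum_comm]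
  simp only [mul_comm]

lemma killingForm_eq_sum (x y : LieAlg A) : killingForm ℂ (LieAlg A) x y =
    ∑ i, ∑ k, b.repr ⁅x, b k⁆ i * b.repr ⁅y, b i⁆ k := by
  classical
  rw [killingForm_apply_apply, LinearMap.trace_eq_matrix_trace ℂ b,
    LinearMap.toMatrix_comp b b b]
  simp [Matrix.trace, Matrix.mul_apply, LinearMap.toMatrix_apply]

/-- Each derivative produces one structure constant; summing over the repeated indices is the trace
of `ad z ∘ ad bₖ`. This is the correction that turns the level into its dual. -/
lemma IsInvariantFamily.sum_iL_iL (hf : IsInvariantFamily b f) (z : LieAlg A) :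
    ∑ i, iL (b i) (iL z (f i)) = - ∑ k, killingForm ℂ (LieAlg A) z (b k) • f k := by
  have h (i k) : iL (b i) (f k) = ∑ l, b.repr ⁅b l, b i⁆ k • f l := by
    rw [hf, ← Finset.sum_neg_distrib]
    refine Finset.sum_congr rfl fun l _ ↦ ?_
    rw [← lie_skew, map_neg, Finsupp.neg_apply, neg_smul, neg_neg]
  simp only [hf z, map_neg, map_sum, Derivation.map_smul, h, killingForm_eq_sum (b := b),
    Finset.smul_sum, Finset.sum_smul, smul_smul, Finset.sum_neg_distrib]
  congr 1
  rw [Finset.sum_congr rfl fun i _ ↦ Finset.sum_comm, Finset.sum_comm]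

/-- Rewriting `bᵢ(fₖ)` as `∑ₗ [bₗ, bᵢ]ᵏ fₗ` leaves the summed indices `i`, `j` cyclically
contracted, hence a trace. -/
lemma IsInvariantFamily.sum_iL_mul_iL (hf : IsInvariantFamily b f) (hg : IsInvariantFamily b g) :
    ∑ i, ∑ j, iL (b i) (g j) * iL (b j) (f i) =
      ∑ i, ∑ j, killingForm ℂ (LieAlg A) (b i) (b j) • (f i * g j) := by
  have h {f : ι → A} (hf : IsInvariantFamily b f) (i k) :
      iL (b i) (f k) = ∑ l, b.repr ⁅b l, b i⁆ k • f l := by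
    rw [hf, ← Finset.sum_neg_distrib]
    refine Finset.sum_congr rfl fun l _ ↦ ?_
    rw [← lie_skew, map_neg, Finsupp.neg_apply, neg_smul, neg_neg]
  simp only [h hf, h hg, killingForm_eq_sum (b := b), Finset.sum_mul_sum, Finset.sum_smul]
  have comm (F : ι → ι → ι → ι → A) :
      ∑ i, ∑ j, ∑ l, ∑ m, F i j l m = ∑ m, ∑ l, ∑ i, ∑ j, F i j l m := by
    calc _ = ∑ i, ∑ l, ∑ m, ∑ j, F i j l m := Finset.sum_congr rfl fun i _ ↦ by
          rw [Finset.sum_comm]; exact Finset.sum_congr rfl fun l _ ↦ Finset.sum_comm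
      _ = ∑ l, ∑ m, ∑ i, ∑ j, F i j l m := by
          rw [Finset.sum_comm]; exact Finset.sum_congr rfl fun l _ ↦ Finset.sum_comm
      _ = _ := Finset.sum_comm
  rw [comm]
  refine Finset.sum_congr rfl fun m _ ↦ Finset.sum_congr rfl fun l _ ↦
    Finset.sum_congr rfl fun i _ ↦ Finset.sum_congr rfl fun j _ ↦ ?_
  rw [smul_mul_smul_comm, mul_comm (g l), mul_comm (b.repr _ _)]

/-- An invariant form of two invariant families is killed by all vector fields. -/
lemma IsInvariantFamily.iL_form (hf : IsInvariantFamily b f) (hg : IsInvariantFamily b g)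
    {β : LinearMap.BilinForm ℂ (LieAlg A)} (hβ : β.lieInvariant (LieAlg A)) (y : LieAlg A) :
    iL y (∑ i, ∑ j, β (b i) (b j) • (f i * g j)) = 0 := by
  have h1 (i) : ∑ j, β (b i) (b j) • (f i * g j) = f i * ∑ j, β (b i) (b j) • g j := by
    simp only [Finset.mul_sum, mul_smul_comm]
  have h2 (j) : ∑ i, iL y (f i) * (β (b i) (b j) • g j) =
      - ∑ i, f i * (β ⁅y, b i⁆ (b j) • g j) := by
    have := congrArg (· * g j) (hf.iL_sum (LinearMap.flip (β : LieAlg A →ₗ[ℂ] LieAlg A →ₗ[ℂ] ℂ) (b j)) y)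
    simp only [map_sum, Derivation.map_smul, LinearMap.flip_apply, Finset.sum_mul, neg_mul] at this
    simpa only [mul_smul_comm, smul_mul_assoc] using this
  simp only [h1, map_sum, Derivation.leibniz, smul_eq_mul]
  simp only [← map_sum, hg.iL_sum (β (b _)) y]
  have h3 : ∑ i, (∑ j, β (b i) (b j) • g j) * iL y (f i) =
      ∑ j, ∑ i, iL y (f i) * (β (b i) (b j) • g j) := by
    rw [Finset.sum_comm]
    exact Finset.sum_congr rfl fun i _ ↦ by rw [mul_comm, Finset.mul_sum]
  -- The two Leibniz terms are `β(bᵢ, [y, bⱼ])` and `β([y, bᵢ], bⱼ)` contracted with `fᵢ gⱼ`, both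
  -- with a minus sign; invariance of `β` makes them cancel.
  rw [Finset.sum_add_distrib, h3, Finset.sum_congr rfl fun j _ ↦ h2 j]
  simp only [hβ y, Finset.sum_neg_distrib, neg_smul, mul_neg, neg_neg, Finset.mul_sum]
  rw [Finset.sum_comm (γ := ι)]
  simp

end InvariantFamily

/-! ### Right-invariant fields in a left-invariant frame. -/

section Frame

variable {A : Type u} [CommRing A] [HopfAlgebra ℂ A] [Algebra.FiniteType ℂ A]
  {ι : Type*} (b : Module.Basis ι ℂ (LieAlg A))

/-- The frame of left-invariant vector fields given by a basis of the Lie algebra. -/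
def frameBasis : Module.Basis ι A (VectorFields A) := (b.baseChange A).map (frame A)

@[simp] lemma frameBasis_apply (i : ι) : frameBasis b i = iL (b i) := by
  simp [frameBasis]

variable [Fintype ι]

lemma frameBasis_repr_iL (x : LieAlg A) (i : ι) :
    (frameBasis b).repr (iL x) i = algebraMap ℂ A (b.repr x i) := by
  have h : (iL x : VectorFields A) =
      ∑ j, algebraMap ℂ A (b.repr x j) • frameBasis b j := by
    conv_lhs => rw [← b.sum_repr x, ← LieHom.coe_toLinearMap, map_sum]
    refine Finset.sum_congr rfl fun j _ ↦ ?_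
    rw [map_smul, frameBasis_apply, algebraMap_smul]; rfl
  rw [h, Module.Basis.repr_sum_self]

variable {b}

/-- The coordinates of a right-invariant vector field. -/
lemma isInvariantFamily_iR (x : LieAlg A) :
    IsInvariantFamily b ((frameBasis b).repr (iR x)) := by
  intro y i
  set f := (frameBasis b).repr (iR x) with hf
  -- The coordinates of `0 = [y, ∑ fₖ bₖ] = ∑ y(fₖ) bₖ + ∑ fₖ [y, bₖ]` are the required equations.
  have h := lie_iL_iR y x
  rw [← (frameBasis b).sum_repr (iR x), lie_sum] at h
  simp only [lie_smul_vectorField, Finset.sum_add_distrib, ← hf] at h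
  have h2 := congrArg (fun D ↦ (frameBasis b).repr D i) h
  simp only [map_add, map_zero, Finsupp.add_apply, Finsupp.zero_apply,
    Module.Basis.repr_sum_self] at h2
  rw [map_sum, Finset.sum_apply'] at h2
  simp only [frameBasis_apply, iL_lie_iL, map_smul, Finsupp.smul_apply, frameBasis_repr_iL,
    smul_eq_mul] at h2
  rw [eq_neg_iff_add_eq_zero, add_comm, ← h2]
  congr 1
  exact Finset.sum_congr rfl fun k _ ↦ by rw [Algebra.smul_def, mul_comm]

/-- At the identity the right- and left-invariant fields of `x` are opposite tangent vectors,
inversion having derivative `-1`. -/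
lemma sum_counit_smul (x : LieAlg A) :
    ∑ i, Coalgebra.counit (R := ℂ) ((frameBasis b).repr (iR x) i) • b i = - x := by
  refine tangentMap_injective (LinearMap.ext fun f ↦ ?_)
  rw [map_neg, LinearMap.neg_apply, ← counit_iR, map_sum, LinearMap.sum_apply]
  conv_rhs => rw [← (frameBasis b).sum_repr (iR x)]
  have hE : (∑ i, (frameBasis b).repr (iR x) i • frameBasis b i : VectorFields A) f =
      ∑ i, (frameBasis b).repr (iR x) i * iL (b i) f := by
    refine (congrFun (map_sum (Derivation.coeFnAddMonoidHom (R := ℂ) (A := A) (M := A))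
      (fun i ↦ (frameBasis b).repr (iR x) i • frameBasis b i) Finset.univ) f).trans ?_
    refine (Finset.sum_apply _ _ _).trans ?_
    simp
  rw [hE, map_sum]
  simp [tangentMap_apply]

/-- On a connected group an invariant form of two right-invariant vector fields is constant. -/
lemma sum_form_iR [ConnectedSpace (PrimeSpectrum A)]
    {β : LinearMap.BilinForm ℂ (LieAlg A)} (hβ : β.lieInvariant (LieAlg A)) (x y : LieAlg A) :
    ∑ i, ∑ j, β (b i) (b j) • ((frameBasis b).repr (iR x) i * (frameBasis b).repr (iR y) j) =
      algebraMap ℂ A (β x y) := by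
  rw [eq_algebraMap_counit ((isInvariantFamily_iR x).iL_form (isInvariantFamily_iR y) hβ)]
  congr 1
  -- Both fields take the values `-x`, `-y` at the identity; the signs cancel in a bilinear form.
  have h : β x y = β (-x) (-y) := by simp
  rw [h, ← sum_counit_smul (b := b), ← sum_counit_smul (b := b) y]
  simp only [map_sum, map_smul, LinearMap.sum_apply, LinearMap.smul_apply, smul_eq_mul,
    Bialgebra.counit_mul, Finset.mul_sum]
  rw [Finset.sum_comm]
  refine Finset.sum_congr rfl fun i _ ↦ Finset.sum_congr rfl fun j _ ↦ by ring

end Frame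
-- The one-form component of the right embedding and the pairings it enters.
section DualForm

variable {A : Type u} [CommRing A] [HopfAlgebra ℂ A]

lemma dualLevel_apply (B : LinearMap.BilinForm ℂ (LieAlg A)) (x y : LieAlg A) :
    dualLevel B x y = - killingForm ℂ (LieAlg A) x y - B x y := rfl

lemma dualLevel_isSymm {B : LinearMap.BilinForm ℂ (LieAlg A)} (hsymm : B.IsSymm) :
    (dualLevel B).IsSymm where
  eq x y := by
    have h : killingForm ℂ (LieAlg A) x y = killingForm ℂ (LieAlg A) y x :=
      LieModule.traceForm_comm ℂ (LieAlg A) (LieAlg A) x y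
    simp [dualLevel_apply, h, hsymm.eq x y]

lemma dualLevel_lieInvariant {B : LinearMap.BilinForm ℂ (LieAlg A)}
    (hinv : B.lieInvariant (LieAlg A)) : (dualLevel B).lieInvariant (LieAlg A) := by
  intro x y z
  have h := LieModule.traceForm_lieInvariant ℂ (LieAlg A) (LieAlg A) x y z
  change killingForm ℂ (LieAlg A) ⁅x, y⁆ z = - killingForm ℂ (LieAlg A) y ⁅x, z⁆ at h
  rw [dualLevel_apply, dualLevel_apply, h, hinv x y z]
  ring

variable [Algebra.FiniteType ℂ A]

/-- The coordinates of the right-invariant vector field of `x` in a left-invariant frame. -/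
def rightCoord (x : LieAlg A) : Fin (Module.finrank ℂ (LieAlg A)) → A :=
  (frameBasis (Module.finBasis ℂ (LieAlg A))).repr (iR x)

lemma sum_rightCoord (x : LieAlg A) :
    ∑ i, rightCoord x i • iL (Module.finBasis ℂ (LieAlg A) i) = (iR x : VectorFields A) := by
  have h := (frameBasis (Module.finBasis ℂ (LieAlg A))).sum_repr (iR x)
  simp only [frameBasis_apply] at h
  exact h

lemma isInvariantFamily_rightCoord (x : LieAlg A) :
    IsInvariantFamily (Module.finBasis ℂ (LieAlg A)) (rightCoord x) :=
  isInvariantFamily_iR x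

variable (B : LinearMap.BilinForm ℂ (LieAlg A))

/-- The `1`-form `z ↦ (z, i_R(x))ᵒ`, where the dual level is extended `A`-bilinearly. -/
def dualForm : LieAlg A →ₗ[ℂ] Forms A :=
  ((frameBasis (Module.finBasis ℂ (LieAlg A))).constr ℂ).toLinearMap ∘ₗ
    LinearMap.pi fun i ↦ ∑ j, dualLevel B (Module.finBasis ℂ (LieAlg A) i)
      (Module.finBasis ℂ (LieAlg A) j) •
        ((((frameBasis (Module.finBasis ℂ (LieAlg A))).coord j).restrictScalars ℂ) ∘ₗ
          (iR (A := A) : LieAlg A →ₗ[ℂ] VectorFields A))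

lemma dualForm_iL (x z : LieAlg A) : dualForm B x (iL z) =
    ∑ j, dualLevel B z (Module.finBasis ℂ (LieAlg A) j) • rightCoord x j := by
  set b := Module.finBasis ℂ (LieAlg A) with hb
  have h (i) : dualForm B x (iL (b i)) = ∑ j, dualLevel B (b i) (b j) • rightCoord x j := by
    rw [← frameBasis_apply, dualForm, LinearMap.comp_apply]
    refine (Module.Basis.constr_basis _ ℂ _ i).trans ?_
    simp [rightCoord, ← hb]
  have hz : (iL z : VectorFields A) = ∑ i, algebraMap ℂ A (b.repr z i) • iL (b i) := by
    conv_lhs => rw [← (frameBasis b).sum_repr (iL z)]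
    simp only [frameBasis_repr_iL, frameBasis_apply]
  rw [hz, map_sum]
  conv_rhs => rw [← b.sum_repr z]
  simp only [map_smul, h, map_sum, LinearMap.sum_apply, LinearMap.smul_apply, Finset.sum_smul,
    smul_eq_mul, Finset.mul_sum, ← Algebra.smul_def, smul_smul]
  exact Finset.sum_comm

/-- The first-order part contributes `B`, the second-order part the Killing form through
`sum_iL_iL`; together they are minus the dual level. This dictates the choice of `dualForm`. -/
lemma groupPair_iL_iR (x z : LieAlg A) : groupPair B (iL z) (iR x) = - dualForm B x (iL z) := by
  have h (a : A) (y : LieAlg A) : groupPair B (iL z) (a • iL y) = B z y • a - iL y (iL z a) := by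
    have := groupPair_apply B 1 a z y
    rw [one_smul] at this
    simpa using this
  rw [← sum_rightCoord, map_sum, dualForm_iL]
  simp only [h, Finset.sum_sub_distrib]
  rw [(isInvariantFamily_rightCoord x).sum_iL_iL, ← Finset.sum_neg_distrib, ← Finset.sum_sub_distrib,
    ← Finset.sum_neg_distrib]
  refine Finset.sum_congr rfl fun i _ ↦ ?_
  rw [dualLevel_apply]
  module

/-- Makes `½ d⟨iL z, τ⟩ - c(iL z, τ)` vanish in the zeroth product. -/
lemma groupC₂_iL (z : LieAlg A) (τ : VectorFields A) :
    groupC₂ B (iL z) τ = dR (groupPair B (iL z) τ) := by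
  induction τ using frame_induction with
  | add τ σ hτ hσ => rw [map_add, hτ, hσ, map_add, map_add]
  | smul a y =>
  have h1 := groupC₂_apply B 1 a z y
  have h2 := groupPair_apply B 1 a z y
  rw [one_smul] at h1 h2
  rw [h1, h2]
  ext; simp

lemma lieDer_iL_dualForm (hinv : B.lieInvariant (LieAlg A)) (x z : LieAlg A) :
    lieDer (iL z) (dualForm B x) = 0 := by
  refine forms_ext fun y ↦ ?_
  rw [lieDer_apply, iL_lie_iL, dualForm_iL, dualForm_iL, (isInvariantFamily_rightCoord x).iL_sum]
  simp only [dualLevel_lieInvariant hinv z y, neg_smul, Finset.sum_neg_distrib]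
  rw [sub_neg_eq_add]
  exact neg_add_cancel _

lemma dualForm_iR [ConnectedSpace (PrimeSpectrum A)] (hinv : B.lieInvariant (LieAlg A))
    (x y : LieAlg A) : dualForm B y (iR x) = algebraMap ℂ A (dualLevel B x y) := by
  rw [← sum_rightCoord x, map_sum]
  simp only [map_smul, dualForm_iL, smul_eq_mul, Finset.mul_sum, mul_smul_comm]
  exact sum_form_iR (dualLevel_lieInvariant hinv) x y

/-- Of the three derivative terms in the pairing, the two second-order ones each give `+K` and the
product of first derivatives gives `-K`. The total `B + K` is minus the dual level, contracted to a
constant. -/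
lemma groupPair_iR_iR [ConnectedSpace (PrimeSpectrum A)] (hinv : B.lieInvariant (LieAlg A))
    (x y : LieAlg A) : groupPair B (iR x) (iR y) = - algebraMap ℂ A (dualLevel B x y) := by
  set b := Module.finBasis ℂ (LieAlg A) with hb
  have hc : ∑ i, ∑ j, dualLevel B (b i) (b j) • (rightCoord x i * rightCoord y j) =
    algebraMap ℂ A (dualLevel B x y) := sum_form_iR (dualLevel_lieInvariant hinv) x y
  have hx := isInvariantFamily_rightCoord x
  have hy := isInvariantFamily_rightCoord y
  have h1 : ∑ i, ∑ j, rightCoord x i * iL (b j) (iL (b i) (rightCoord y j)) =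
      - ∑ i, ∑ j, killingForm ℂ (LieAlg A) (b i) (b j) • (rightCoord x i * rightCoord y j) := by
    simp only [← Finset.mul_sum, hb, hy.sum_iL_iL, mul_neg, Finset.sum_neg_distrib]
    simp only [Finset.mul_sum, mul_smul_comm]
  have h2 : ∑ i, ∑ j, rightCoord y j * iL (b i) (iL (b j) (rightCoord x i)) =
      - ∑ i, ∑ j, killingForm ℂ (LieAlg A) (b i) (b j) • (rightCoord x i * rightCoord y j) := by
    rw [Finset.sum_comm]
    simp only [← Finset.mul_sum, hb, hx.sum_iL_iL, mul_neg, Finset.sum_neg_distrib]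
    simp only [Finset.mul_sum, mul_smul_comm]
    rw [Finset.sum_comm]
    refine congrArg _ (Finset.sum_congr rfl fun i _ ↦ Finset.sum_congr rfl fun j _ ↦ ?_)
    rw [mul_comm, show ∀ u v : LieAlg A, killingForm ℂ (LieAlg A) u v =
      killingForm ℂ (LieAlg A) v u from LieModule.traceForm_comm ℂ (LieAlg A) (LieAlg A)]
  rw [← hc, ← sum_rightCoord x, ← sum_rightCoord y]
  rw [LinearMap.map_sum₂]
  simp only [map_sum, groupPair_apply, Finset.sum_sub_distrib, ← hb]
  rw [h1, h2, hx.sum_iL_mul_iL hy]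
  simp only [dualLevel_apply, sub_smul, neg_smul, Finset.sum_sub_distrib, Finset.sum_neg_distrib]
  abel

end DualForm

/-! ### The right embedding in the vertex algebra. -/

section ChiralAlgebra

open VertexAlgebra GradedVertexAlgebra

variable {A : Type u} [CommRing A] [HopfAlgebra ℂ A]

lemma VertexAlgebroid.Hom.IsCDO.proj_f₁ {𝒜 : VertexAlgebroid A} {V : Type u} [AddCommGroup V]
    [Module ℂ V] [GradedVertexAlgebra V] {φ : 𝒜.Hom V} (h : φ.IsCDO)
    (ξ : VectorFields A × Forms A) (hξ : φ.f₁ ξ ∈ weight (V := V) 1) :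
    h.proj ⟨φ.f₁ ξ, hξ⟩ = ξ.1 := by
  have h1 : h.weightOneEquiv ⟨φ.f₁ ξ, hξ⟩ = ξ := by
    rw [VertexAlgebroid.Hom.IsCDO.weightOneEquiv, LinearEquiv.symm_apply_eq]
    rfl
  exact congrArg Prod.fst h1

/-- If `a` commutes with `b` and `c`, then it commutes with `b₍₀₎c`. -/
lemma nprod_nprod_zero_eq_zero {V : Type u} [AddCommGroup V] [Module ℂ V] [VertexAlgebra V]
    {a b c : V} (hb : ∀ n : ℕ, nprod (n : ℤ) a b = 0) (hc : ∀ n : ℕ, nprod (n : ℤ) a c = 0)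
    (n : ℕ) : nprod (n : ℤ) a (nprod 0 b c) = 0 := by
  -- With `q = r = 0` this is the commutator formula: the left side contains only products `a₍ⱼ₎b`
  -- with `j ≥ 0`, and only `j = 0` survives on the right.
  have h := borcherds n 0 0 a b c
  have h1 (j : ℕ) : nprod (0 + (j : ℤ)) a b = 0 := by rw [zero_add, hb]
  simp only [h1, map_zero, LinearMap.zero_apply, smul_zero, finsum_zero] at h
  rw [finsum_eq_single _ 0 fun j hj ↦ by
    rw [Ring.choose_zero_pos (R := ℤ) (Nat.pos_of_ne_zero hj), mul_zero, zero_smul]] at h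
  simpa [hc] using h.symm

variable [Algebra.FiniteType ℂ A] {B : LinearMap.BilinForm ℂ (LieAlg A)} {hsymm : B.IsSymm}
  {hinv : B.lieInvariant (LieAlg A)} {V : Type u} [AddCommGroup V] [Module ℂ V]
  [GradedVertexAlgebra V] (φ : (groupAlgebroid B hsymm hinv).Hom V)

/-- The embedding `j_R : 𝔤 → V₁ = T ⊕ Ω`. -/
def jR : LieAlg A →ₗ[ℂ] weight (V := V) 1 :=
  LinearMap.codRestrict _ (φ.f₁ ∘ₗ LinearMap.prod
    (iR (A := A) : LieAlg A →ₗ[ℂ] VectorFields A) (dualForm B)) fun _ ↦ φ.mem₁ _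

lemma coe_jR (x : LieAlg A) : (jR φ x : V) = φ.f₁ (iR x, dualForm B x) := rfl

lemma coe_jL (x : LieAlg A) : (jL φ x : V) = φ.f₁ (iL x, 0) := rfl

lemma nprod_jL_jR (x y : LieAlg A) (n : ℕ) : nprod (n : ℤ) (jL φ x : V) (jR φ y : V) = 0 := by
  match n with
  | 0 =>
    rw [Nat.cast_zero, coe_jL, coe_jR, φ.map_lie, lie_iL_iR, lieDer_iL_dualForm B hinv]
    have h : (groupAlgebroid B hsymm hinv).c (iL x) (iR y) =
      (1 / 2 : ℂ) • groupC₂ B (iL x) (iR y) := rfl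
    rw [h, groupC₂_iL]
    have h' : (groupAlgebroid B hsymm hinv).pair = groupPair B := rfl
    rw [h']
    simp only [map_zero, sub_self, add_zero, LinearMap.zero_apply]
    exact map_zero φ.f₁
  | 1 =>
    rw [Nat.cast_one, coe_jL, coe_jR, φ.map_pair]
    have h' : (groupAlgebroid B hsymm hinv).pair = groupPair B := rfl
    rw [h', groupPair_iL_iR]
    simp
  -- The product would have weight `1 + 1 - (n + 2) - 1 < 0`.
  | n + 2 =>
    refine nprod_eq_zero 1 1 _ ?_ _ (jL φ x).2 _ (jR φ y).2
    push_cast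
    linarith

variable {φ}

lemma proj_jR (hφ : φ.IsCDO) (x : LieAlg A) : hφ.proj (jR φ x) = iR x := hφ.proj_f₁ _ _

lemma jR_injective (hφ : φ.IsCDO) : Function.Injective (jR φ) := by
  intro x y h
  apply iR_injective
  rw [← proj_jR hφ, h, proj_jR hφ]

/-- An element of `V₁` commuting with `j_L` is determined by its projection to `T`. -/
lemma eq_of_proj_eq (hφ : φ.IsCDO) {v w : weight (V := V) 1} (h : hφ.proj v = hφ.proj w)
    (hv : ∀ x, nprod 1 (jL φ x : V) (v : V) = 0) (hw : ∀ x, nprod 1 (jL φ x : V) (w : V) = 0) :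
    v = w := by
  obtain ⟨v, hv1⟩ := v
  obtain ⟨w, hw1⟩ := w
  obtain ⟨⟨τ, ω⟩, rfl⟩ := hφ.range₁.symm ▸ hv1
  obtain ⟨⟨τ', ω'⟩, rfl⟩ := hφ.range₁.symm ▸ hw1
  rw [hφ.proj_f₁, hφ.proj_f₁] at h
  obtain rfl : τ = τ' := h
  -- The first product with `iL x` is the pairing of `iL x` with `τ` plus `ω (iL x)`; the pairing is
  -- common to both, and left-invariant fields span `T`.
  have h1 : ω = ω' := by
    refine forms_ext fun x ↦ ?_
    have h := (hv x).trans (hw x).symm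
    rw [coe_jL, φ.map_pair, φ.map_pair] at h
    simpa using hφ.injective₀ h
  subst h1
  rfl

/-- Both sides commute with the left embedding and have the same projection to `T`, so no evaluation
of `c` on right-invariant fields is needed. -/
lemma nprod_zero_jR_jR (hφ : φ.IsCDO) (x y : LieAlg A) :
    nprod 0 (jR φ x : V) (jR φ y : V) = (jR φ ⁅x, y⁆ : V) := by
  have hm : nprod 0 (jR φ x : V) (jR φ y : V) ∈ weight (V := V) 1 :=
    nprod_mem 1 1 1 0 (by norm_num) _ (jR φ x).2 _ (jR φ y).2
  have h : (⟨_, hm⟩ : weight (V := V) 1) = jR φ ⁅x, y⁆ := by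
    refine eq_of_proj_eq hφ ?_ (fun z ↦ ?_) fun z ↦ nprod_jL_jR φ z _ 1
    · rw [proj_jR hφ, LieHom.map_lie]
      have e := φ.map_lie (iR x) (dualForm B x) (iR y) (dualForm B y)
      simp only [coe_jR, e]
      exact hφ.proj_f₁ _ _
    · exact nprod_nprod_zero_eq_zero (nprod_jL_jR φ z x) (nprod_jL_jR φ z y) 1
  exact congrArg Subtype.val h

/-- The pairing of the fields gives `-(x, y)ᵒ` and each of the two evaluations of a one-form gives
`+(x, y)ᵒ`. -/
lemma nprod_one_jR_jR [ConnectedSpace (PrimeSpectrum A)] (x y : LieAlg A) :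
    nprod 1 (jR φ x : V) (jR φ y : V) = dualLevel B x y • vac := by
  rw [coe_jR, coe_jR, φ.map_pair]
  have h' : (groupAlgebroid B hsymm hinv).pair = groupPair B := rfl
  rw [h', groupPair_iR_iR B hinv, dualForm_iR B hinv, dualForm_iR B hinv,
    (dualLevel_isSymm hsymm).eq y x, neg_add_cancel, zero_add, Algebra.algebraMap_eq_smul_one,
    map_smul, φ.map_one]

end ChiralAlgebra
end ChiralDiffOp
end

open ChiralDiffOp VertexAlgebra GradedVertexAlgebra
theorem theorem2p5 {A : Type u} [CommRing A] [HopfAlgebra ℂ A] [Algebra.Smooth ℂ A]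
    [ConnectedSpace (PrimeSpectrum A)]
    (B : LinearMap.BilinForm ℂ (LieAlg A)) (hsymm : B.IsSymm) (hinv : B.lieInvariant (LieAlg A))
    {D : Type u} [AddCommGroup D] [Module ℂ D] [GradedVertexAlgebra D]
    (φ : (groupAlgebroid B hsymm hinv).Hom D) (hφ : φ.IsCDO) :
    ∃ jR : LieAlg A →ₗ[ℂ] weight (V := D) 1,
      Function.Injective jR ∧
      ((∀ x, hφ.proj (jR x) = iR x) ∧
        ∀ (x y : LieAlg A) (n : ℕ), nprod (n : ℤ) (jL φ x : D) (jR y : D) = 0) ∧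
      (∀ j : LieAlg A →ₗ[ℂ] weight (V := D) 1,
        (∀ x, hφ.proj (j x) = iR x) →
        (∀ (x y : LieAlg A) (n : ℕ), nprod (n : ℤ) (jL φ x : D) (j y : D) = 0) → j = jR) ∧
      (∀ x y, nprod 1 (jR x : D) (jR y : D) = dualLevel B x y • vac) ∧
      (∀ x y, nprod 0 (jR x : D) (jR y : D) = jR ⁅x, y⁆) := by
  refine ⟨jR φ, jR_injective hφ, ⟨proj_jR hφ, nprod_jL_jR φ⟩, fun j hj hjL ↦ ?_,
    nprod_one_jR_jR, nprod_zero_jR_jR hφ⟩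
  -- Uniqueness uses only the first product.
  refine LinearMap.ext fun x ↦ eq_of_proj_eq hφ ?_ (fun z ↦ hjL z x 1) fun z ↦ nprod_jL_jR φ z x 1
  rw [hj, proj_jR hφ]
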